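/- Let $X$ be an $n$-dimensional Fano manifold (a compact connected complex manifold with $-K_X$ ample), let $k\ge 1$ be such that $-kK_X$ is very ample, and put $N=N_k=\dim H^0(X,-kK_X)$. Let $\mathcal B_k$ be the space of positive definite hermitian forms on $H^0(X,-kK_X)$. For $H\in\mathcal B_k$ let $FS_k(H)$ be the metric on $-K_X$ with local weights $\frac1k\log\bigl(k^{-n}\sup_{s\ne0}|s|^2/H(s,s)\bigr)$. For a metric $\phi$ on $-K_X$ let $e^{-\phi}$ be the volume form given in local holomorphic coordinates $z$ by $(\sqrt{-1})^{n^2}\,|\partial_{z_1}\wedge\cdots\wedge\partial_{z_n}|^2_\phi\,dz_1\wedge\cdots\wedge dz_n\wedge d\bar z_1\wedge\cdots\wedge d\bar z_n$, let $\mu_\phi=e^{-\phi}/\int_Xe^{-\phi}$, and let $\mathcal L(\phi)=-\log\int_Xe^{-\phi}$. Fix $H_{\rm ref}\in\mathcal B_k$. The quantized Ding functional on $\mathcal B_k$ is $$\mathcal D^{(k)}(H)=\frac1{kN}\log\det(H\cdot H_{\rm ref}^{-1})+\mathcal L(FS_k(H)).$$ Fix $H_0\in\mathcal B_k$ and an $H_0$-orthonormal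 basis $\underline s_0=(s_1,\dots,s_N)$. It defines an embedding of $X$ into $\mathbb{CP}^{N-1}$ by $x\mapsto[s_1(x):\cdots:s_N(x)]$; functions on $\mathbb{CP}^{N-1}$ are restricted to $X$ by means of it. For $g\in GL(N,\mathbb C)$ let $H_g\in\mathcal B_k$ be the form for which $\underline s_0\cdot g$ is orthonormal. The map $g\mapsto H_g$ identifies $GL(N,\mathbb C)/U(N)$ with $\mathcal B_k$, and a hermitian $N\times N$ matrix $A$ with the tangent vector $\frac{d}{dt}\big|_{t=0}H_{e^{tA/2}}$ at $H_0$. Give $\mathcal B_k$ the $GL(N,\mathbb C)$-invariant Riemannian metric that equals $\mathrm{tr}(AB)$ at $H_0$. On $\mathbb{CP}^{N-1}$ with homogeneous coordinates $Z$ let $M=\bigl(\bar Z_\alpha Z_\beta/\sum_i|Z_i|^2\bigr)_{\alpha\beta}$, let $(\cdot,\cdot)_{FS}$ be the hermitian inner product on holomorphic tangent vectors with components $\partial_i\partial_{\bar j}\log|Z|^2$, and let $\omega_{FS}=\frac{\sqrt{-1}}{2\pi}\partial\bar\partial\log|Z|^2$. For a hermitian matrix $A$ let $\xi_A$ be the holomorphic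 vector field on $\mathbb{CP}^{N-1}$ induced by $\sum_{i,j}A_{ij}Z_i\,\partial/\partial Z_j$, write $\xi_A=\xi_A^{\mathbb R}-\sqrt{-1}J\xi_A^{\mathbb R}$ with $\xi_A^{\mathbb R}$ real, and let $H(A)=\mathrm{tr}(AM)$. Then $\mathcal D^{(k)}$ is twice continuously differentiable at $H_0$, and for all hermitian matrices $A,B$ its Riemannian Hessian at $H_0$ is, with $\mu=\mu_{FS_k(H_0)}$, $$\nabla^2\mathcal D^{(k)}|_{H_0}(A,B)=k^{-1}\int_X\mathrm{Re}(\xi_A,\xi_B)_{FS}\,\mu-k^{-2}\int_XH(A)H(B)\,\mu+k^{-2}\int_XH(A)\,\mu\cdot\int_XH(B)\,\mu.$$ Moreover $H(A)$ is the Hamiltonian of $J\xi_A^{\mathbb R}$, in the sense that $i_{J\xi_A^{\mathbb R}}\omega_{FS}=-\frac1{4\pi}dH(A)$. -/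

import Mathlib

open scoped Manifold ContDiff Matrix LinearAlgebra.Projectivization Matrix.Norms.Operator

namespace QuantizedDing

noncomputable section

/-! ### Pluri-anticanonical bundles and their holomorphic sections -/

/-- The model space of an `n`-dimensional complex manifold. -/
abbrev Model (n : ℕ) : Type := Fin n → ℂ

theorem contDiff_det (n : ℕ) : ContDiff ℂ ω (fun f : Model n →L[ℂ] Model n => f.det) := by
  have h : (fun f : Model n →L[ℂ] Model n => f.det) =
      fun f => ∑ σ : Equiv.Perm (Fin n), ((Equiv.Perm.sign σ : ℤ) : ℂ) *
        ∏ i, f (Pi.single i 1) (σ i) := by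
    funext f
    rw [ContinuousLinearMap.det, ← LinearMap.det_toMatrix', Matrix.det_apply']
    simp [LinearMap.toMatrix'_apply]
  rw [h]
  refine ContDiff.sum fun σ _ => contDiff_const.mul (contDiff_prod fun i _ => ?_)
  exact ((ContinuousLinearMap.proj (R := ℂ) (φ := fun _ : Fin n => ℂ) (σ i)).comp
    (ContinuousLinearMap.apply ℂ (Model n) (Pi.single i 1 : Model n))).contDiff

section Manifold

variable (n : ℕ) (X : Type*) [TopologicalSpace X] [ChartedSpace (Model n) X]
  [IsManifold 𝓘(ℂ, Model n) ω X]

/-- The holomorphic line bundle `-k K_X = (Λⁿ T X)^{⊗ k}` of a complex manifold `X`.  It is given by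
its trivialisations over the charts of `X`: the chart `i = (z₁, …, zₙ)` provides the frame
`(∂/∂z₁ ∧ ⋯ ∧ ∂/∂zₙ)^{⊗ k}`.  If `J` is the Jacobian matrix of the change of charts from `i` to `j`
(the transition function of the tangent bundle), then the frame of `i` is `(det J)^k` times that
of `j`, so that coefficients are multiplied by `(det J)^k`. -/
def anticanonicalCore (k : ℕ) : VectorBundleCore ℂ X ℂ (atlas (Model n) X) where
  baseSet i := i.1.source
  isOpen_baseSet i := i.1.open_source
  indexAt := achart (Model n)
  mem_baseSet_at := mem_chart_source (Model n)
  coordChange i j x :=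
    (((tangentBundleCore 𝓘(ℂ, Model n) X).coordChange i j x).det ^ k) •
      ContinuousLinearMap.id ℂ ℂ
  coordChange_self i x hx v := by
    have h : (tangentBundleCore 𝓘(ℂ, Model n) X).coordChange i i x =
        ContinuousLinearMap.id ℂ (Model n) :=
      ContinuousLinearMap.ext fun w =>
        (tangentBundleCore 𝓘(ℂ, Model n) X).coordChange_self i x hx w
    rw [h]
    simp [ContinuousLinearMap.det]
  continuousOn_coordChange i j := by
    have h : ContinuousOn
        (fun x => ((tangentBundleCore 𝓘(ℂ, Model n) X).coordChange i j x).det)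
        (i.1.source ∩ j.1.source) :=
      (contDiff_det n).continuous.comp_continuousOn
        ((tangentBundleCore 𝓘(ℂ, Model n) X).continuousOn_coordChange i j)
    exact (h.pow k).smul continuousOn_const
  coordChange_comp i j l x hx v := by
    have h : (tangentBundleCore 𝓘(ℂ, Model n) X).coordChange i l x =
        ((tangentBundleCore 𝓘(ℂ, Model n) X).coordChange j l x).comp
          ((tangentBundleCore 𝓘(ℂ, Model n) X).coordChange i j x) :=
      ContinuousLinearMap.ext fun w =>
        ((tangentBundleCore 𝓘(ℂ, Model n) X).coordChange_comp i j l x hx w).symm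
    have hdet : ((tangentBundleCore 𝓘(ℂ, Model n) X).coordChange i l x).det =
        ((tangentBundleCore 𝓘(ℂ, Model n) X).coordChange j l x).det *
          ((tangentBundleCore 𝓘(ℂ, Model n) X).coordChange i j x).det := by
      rw [h]
      exact LinearMap.det_comp _ _
    rw [hdet]
    simp only [smul_apply, ContinuousLinearMap.id_apply, smul_eq_mul, mul_pow]
    ring

instance anticanonicalCore_isContMDiff (k : ℕ) :
    (anticanonicalCore n X k).IsContMDiff 𝓘(ℂ, Model n) ω where
  contMDiffOn_coordChange i j := by
    have hI : IsManifold 𝓘(ℂ, Model n) (ω + 1) X := by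
      simpa using (inferInstance : IsManifold 𝓘(ℂ, Model n) ω X)
    have hT : (tangentBundleCore 𝓘(ℂ, Model n) X).IsContMDiff 𝓘(ℂ, Model n) ω :=
      tangentBundleCore.isContMDiff
    have h1 : ContDiff ℂ ω (fun f : Model n →L[ℂ] Model n =>
        (f.det ^ k) • ContinuousLinearMap.id ℂ ℂ) :=
      ((contDiff_det n).pow k).smul contDiff_const
    exact h1.contMDiff.comp_contMDiffOn (hT.contMDiffOn_coordChange i j)

/-- `H⁰(X, -k K_X)`, the complex vector space of holomorphic (that is, complex analytic) sections
of `-k K_X`. -/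
abbrev H0 (k : ℕ) : Type _ :=
  ContMDiffSection 𝓘(ℂ, Model n) ℂ ω (anticanonicalCore n X k).Fiber

variable {n X}

/-- The coefficient of the section `s` of `-k K_X` at the point `x` with respect to the frame
`(∂/∂z₁ ∧ ⋯ ∧ ∂/∂zₙ)^{⊗ k}` of the chart `i` (meaningful for `x` in the source of `i`). -/
def coeff {k : ℕ} (i : atlas (Model n) X) (s : H0 n X k) (x : X) : ℂ :=
  ((anticanonicalCore n X k).localTriv i ⟨x, s x⟩).2

variable (n X)

/-- `-k K_X` is very ample: its holomorphic sections have no common zeros, separate points, and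
separate tangent vectors. -/
structure IsVeryAmple (k : ℕ) : Prop where
  basePointFree : ∀ x : X, ∃ s : H0 n X k, s x ≠ 0
  separatesPoints : ∀ x y : X, x ≠ y → ∃ s : H0 n X k, s x = 0 ∧ s y ≠ 0
  separatesTangents : ∀ (x : X) (v : TangentSpace 𝓘(ℂ, Model n) x), v ≠ 0 →
    ∃ s : H0 n X k, s x = 0 ∧
      mfderiv 𝓘(ℂ, Model n) 𝓘(ℂ, ℂ) (coeff (achart (Model n) x) s) x v ≠ 0

/-- `-K_X` is ample, i.e. some positive multiple of it is very ample. -/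
def IsFano : Prop := ∃ m : ℕ, 0 < m ∧ IsVeryAmple n X m

end Manifold

/-! ### Hermitian forms -/

section Forms

variable {V : Type*} [AddCommGroup V] [Module ℂ V]

/-- Sesquilinear forms on `V`, conjugate linear in the first variable. -/
abbrev SesqForm (V : Type*) [AddCommGroup V] [Module ℂ V] : Type _ := V →ₗ⋆[ℂ] V →ₗ[ℂ] ℂ

/-- `H` is a (positive definite) hermitian form. The set of these is the space `𝓑_k` when
`V = H⁰(X, -k K_X)`. -/
def IsHermForm (H : SesqForm V) : Prop := H.IsSymm ∧ ∀ v, v ≠ 0 → 0 < (H v v).re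

variable {N : ℕ}

/-- The Gram matrix of `H` in the basis `b`. -/
def gram (b : Module.Basis (Fin N) ℂ V) (H : SesqForm V) : Matrix (Fin N) (Fin N) ℂ :=
  Matrix.of fun i j => H (b i) (b j)

/-- Hermitian matrices of size `N`, a real vector space (`√-1 𝔲(N)`). -/
abbrev HermMat (N : ℕ) : Type := selfAdjoint.submodule ℝ (Matrix (Fin N) (Fin N) ℂ)

/-- For a matrix `G = g gᴴ` with `g ∈ GL(N, ℂ)`, this is the hermitian form `H_g` for which
`s · g`, i.e. the family `(∑ᵢ g i j • s i)_j`, is orthonormal. Its Gram matrix in the basis `s` is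
`G⁻¹`.  As `g ↦ g gᴴ` identifies `GL(N, ℂ) / U(N)` with the open cone of positive definite matrices
in `HermMat N`, this parametrises all (positive definite) hermitian forms on `V` by that cone. -/
def formOf (s : Module.Basis (Fin N) ℂ V) (G : Matrix (Fin N) (Fin N) ℂ) : SesqForm V :=
  LinearMap.mk₂'ₛₗ (starRingEnd ℂ) (RingHom.id ℂ)
    (fun x y => star (⇑(s.repr x)) ⬝ᵥ (G⁻¹ *ᵥ ⇑(s.repr y)))
    (fun x y z => by simp [add_dotProduct])
    (fun c x y => by
      have h : star (⇑(c • s.repr x)) = (starRingEnd ℂ c) • star (⇑(s.repr x)) := by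
        ext i; simp
      rw [map_smul, h, smul_dotProduct])
    (fun x y z => by simp [Matrix.mulVec_add, dotProduct_add])
    (fun c x y => by simp [Matrix.mulVec_smul, dotProduct_smul])

theorem formOf_apply_basis (s : Module.Basis (Fin N) ℂ V) (G : Matrix (Fin N) (Fin N) ℂ)
    (i j : Fin N) : formOf s G (s i) (s j) = G⁻¹ i j := by
  simp [formOf, LinearMap.mk₂'ₛₗ_apply, Finsupp.single_eq_pi_single]

theorem formOf_orthonormal (s : Module.Basis (Fin N) ℂ V) (g : Matrix (Fin N) (Fin N) ℂ)
    (hg : IsUnit g.det) (a b : Fin N) :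
    formOf s (g * gᴴ) (∑ i, g i a • s i) (∑ j, g j b • s j) = if a = b then 1 else 0 := by
  have hg' : IsUnit (gᴴ).det := by rw [Matrix.det_conjTranspose]; exact hg.star
  have h : gᴴ * (g * gᴴ)⁻¹ * g = 1 := by
    rw [Matrix.mul_inv_rev, ← Matrix.mul_assoc, Matrix.mul_nonsing_inv _ hg', Matrix.one_mul,
      Matrix.nonsing_inv_mul _ hg]
  rw [← Matrix.one_apply, ← h]
  simp only [map_sum, LinearMap.sum_apply, LinearMap.map_smulₛₗ, LinearMap.smul_apply,
    formOf_apply_basis, Matrix.mul_apply, Finset.sum_mul, Matrix.conjTranspose_apply, smul_eq_mul,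
    Finset.mul_sum, RingHom.id_apply, starRingEnd_apply]
  exact Finset.sum_congr rfl fun i _ => Finset.sum_congr rfl fun j _ => by ring

end Forms

/-! ### The Riemannian structure of the space of hermitian forms -/

section Riemannian

variable {N : ℕ}

/-- The identity matrix. Under `formOf s` it corresponds to the form with orthonormal basis `s`. -/
def idHerm (N : ℕ) : HermMat N := ⟨1, IsSelfAdjoint.one _⟩

/-- The Riemannian metric on the cone of positive definite matrices that is invariant under
`G ↦ g G gᴴ`, `g ∈ GL(N, ℂ)`, and equal to `tr (U V)` at the identity. -/
def killingMetric (G U V : HermMat N) : ℝ := (G.1⁻¹ * U.1 * G.1⁻¹ * V.1).trace.re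

/-- The Christoffel symbols `Γ_G(U, V)` of the Levi-Civita connection of `killingMetric`, so that
`∇_U V = D_U V + Γ(U, V)` for vector fields `U`, `V`. -/
def christoffel (G U V : HermMat N) : HermMat N :=
  ⟨-((1 / 2 : ℝ) • (U.1 * G.1⁻¹ * V.1 + V.1 * G.1⁻¹ * U.1)), by
    have hG : star (G.1⁻¹) = G.1⁻¹ := by
      have h : star G.1 = G.1 := G.2
      rw [Matrix.star_eq_conjTranspose] at h ⊢
      rw [Matrix.conjTranspose_nonsing_inv, h]
    have hU : star U.1 = U.1 := U.2
    have hV : star V.1 = V.1 := V.2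
    change star (-((1 / 2 : ℝ) • (U.1 * G.1⁻¹ * V.1 + V.1 * G.1⁻¹ * U.1))) = _
    rw [star_neg, star_smul, star_add, star_mul, star_mul, star_mul, star_mul, hG, hU, hV,
      star_trivial, add_comm, Matrix.mul_assoc, Matrix.mul_assoc]⟩

theorem hasDerivAt_killingMetric (G U V W : HermMat N) (hG : IsUnit G.1.det) :
    HasDerivAt (fun t : ℝ => killingMetric (G + t • U) V W)
      (-(G.1⁻¹ * U.1 * G.1⁻¹ * V.1 * G.1⁻¹ * W.1).trace.re
        - (G.1⁻¹ * V.1 * G.1⁻¹ * U.1 * G.1⁻¹ * W.1).trace.re) 0 := by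
  have hunit : IsUnit G.1 := (Matrix.isUnit_iff_isUnit_det _).2 hG
  obtain ⟨u, hu⟩ := hunit
  have hinv : (↑u⁻¹ : Matrix (Fin N) (Fin N) ℂ) = G.1⁻¹ := by
    rw [← hu, Matrix.coe_units_inv]
  have h0 : HasDerivAt (fun t : ℝ => G.1 + t • U.1) U.1 0 := by
    have h := ((hasDerivAt_id (0 : ℝ)).smul_const U.1).const_add G.1
    rw [one_smul] at h
    exact h
  have h1 : HasDerivAt (fun t : ℝ => (G.1 + t • U.1)⁻¹) (-(G.1⁻¹ * U.1 * G.1⁻¹)) 0 := by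
    have hr := hasFDerivAt_ringInverse (𝕜 := ℝ) u
    have hr' : HasFDerivAt Ring.inverse
        (-((ContinuousLinearMap.mulLeftRight ℝ (Matrix (Fin N) (Fin N) ℂ)) ↑u⁻¹) ↑u⁻¹)
        (G.1 + (0 : ℝ) • U.1) := by simpa [hu] using hr
    have hc := hr'.comp_hasDerivAt (0 : ℝ) h0
    have hd : (-((ContinuousLinearMap.mulLeftRight ℝ (Matrix (Fin N) (Fin N) ℂ)) ↑u⁻¹) ↑u⁻¹) U.1
        = -(G.1⁻¹ * U.1 * G.1⁻¹) := by simp [hinv]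
    rw [hd] at hc
    simp only [Matrix.nonsing_inv_eq_ringInverse] at hc ⊢
    exact hc
  have h2 := (((h1.mul_const V.1).mul h1).mul_const W.1)
  let L : Matrix (Fin N) (Fin N) ℂ →L[ℝ] ℝ :=
    LinearMap.toContinuousLinearMap
      (Complex.reLm ∘ₗ (Matrix.traceLinearMap (Fin N) ℝ ℂ))
  have h3 := L.hasFDerivAt.comp_hasDerivAt (0 : ℝ) h2
  refine h3.congr_deriv ?_
  change (Matrix.trace (_ : Matrix (Fin N) (Fin N) ℂ)).re = _
  simp only [zero_smul, add_zero, Matrix.neg_mul, Matrix.mul_neg, Matrix.add_mul, Matrix.trace_add,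
    Matrix.trace_neg, Complex.add_re, Complex.neg_re, ← Matrix.mul_assoc]
  ring

/-- The Koszul formula: `christoffel` is the Levi-Civita connection of `killingMetric`. -/
theorem koszul (G U V W : HermMat N) (hG : IsUnit G.1.det) :
    2 * killingMetric G (christoffel G U V) W =
      deriv (fun t : ℝ => killingMetric (G + t • U) V W) 0
        + deriv (fun t : ℝ => killingMetric (G + t • V) U W) 0
        - deriv (fun t : ℝ => killingMetric (G + t • W) U V) 0 := by
  rw [(hasDerivAt_killingMetric G U V W hG).deriv, (hasDerivAt_killingMetric G V U W hG).deriv,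
    (hasDerivAt_killingMetric G W U V hG).deriv]
  have e1 : (G.1⁻¹ * W.1 * G.1⁻¹ * U.1 * G.1⁻¹ * V.1).trace =
      (G.1⁻¹ * U.1 * G.1⁻¹ * V.1 * G.1⁻¹ * W.1).trace := by
    rw [show G.1⁻¹ * W.1 * G.1⁻¹ * U.1 * G.1⁻¹ * V.1 =
      (G.1⁻¹ * W.1) * (G.1⁻¹ * U.1 * G.1⁻¹ * V.1) by simp only [Matrix.mul_assoc],
      Matrix.trace_mul_comm]
    simp only [Matrix.mul_assoc]
  have e2 : (G.1⁻¹ * U.1 * G.1⁻¹ * W.1 * G.1⁻¹ * V.1).trace =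
      (G.1⁻¹ * V.1 * G.1⁻¹ * U.1 * G.1⁻¹ * W.1).trace := by
    rw [show G.1⁻¹ * U.1 * G.1⁻¹ * W.1 * G.1⁻¹ * V.1 =
      (G.1⁻¹ * U.1 * G.1⁻¹ * W.1) * (G.1⁻¹ * V.1) by simp only [Matrix.mul_assoc],
      Matrix.trace_mul_comm]
    simp only [Matrix.mul_assoc]
  rw [e1, e2]
  simp only [killingMetric, christoffel]
  simp only [Matrix.mul_neg, Matrix.neg_mul, Matrix.mul_smul, Matrix.smul_mul, Matrix.mul_add,
    Matrix.add_mul, Matrix.trace_neg, Matrix.trace_smul, Matrix.trace_add, Complex.neg_re,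
    Complex.add_re, Complex.real_smul, Complex.re_ofReal_mul, ← Matrix.mul_assoc]
  ring

/-- The Riemannian Hessian `∇²F(U, V) = D²F(U, V) - DF(Γ(U, V))` of a function `F` at `G`, with
respect to `killingMetric`. -/
def riemannianHessian (F : HermMat N → ℝ) (G U V : HermMat N) : ℝ :=
  fderiv ℝ (fderiv ℝ F) G U V - fderiv ℝ F G (christoffel G U V)

end Riemannian

/-! ### The quantized Ding functional -/

section Ding

variable {n : ℕ} {X : Type*} [TopologicalSpace X] [ChartedSpace (Model n) X]
  [IsManifold 𝓘(ℂ, Model n) ω X]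

/-- The metric `FS_k(H)` on `-K_X`, written additively: in the chart `i = (z₁, …, zₙ)` its weight is
`φ = (1 / k) log (k⁻ⁿ sup_{s ≠ 0} |s|² / H(s, s))`, where sections are written as functions by means
of the frame `(∂/∂z₁ ∧ ⋯ ∧ ∂/∂zₙ)^{⊗ k}`; thus `|∂/∂z₁ ∧ ⋯ ∧ ∂/∂zₙ|²_φ = exp (-φ)`. -/
def fubiniStudyWeight {k : ℕ} (H : SesqForm (H0 n X k)) (i : atlas (Model n) X) (x : X) : ℝ :=
  (1 / (k : ℝ)) * Real.log (((k : ℝ) ^ n)⁻¹ *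
    ⨆ s : {s : H0 n X k // s ≠ 0}, ‖coeff i s.1 x‖ ^ 2 / (H s.1 s.1).re)

/-- The canonical volume form `e^{-φ}` of a metric `φ` on `-K_X` with weights `φ i` (`i` a chart):
in a chart it is `(√-1)^{n²} |∂/∂z₁ ∧ ⋯ ∧ ∂/∂zₙ|²_φ dz₁ ∧ ⋯ ∧ dzₙ ∧ dz̄₁ ∧ ⋯ ∧ dz̄ₙ`, which is
`2ⁿ exp (-φ i)` times Lebesgue measure.  As the local measures agree on overlaps, the measure on `X`
they define is their supremum. -/
def canonicalVolume [MeasurableSpace X] (φ : atlas (Model n) X → X → ℝ) :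
    MeasureTheory.Measure X :=
  ⨆ i : atlas (Model n) X,
    (((MeasureTheory.volume : MeasureTheory.Measure (Model n)).restrict i.1.target).withDensity
      fun z => ENNReal.ofReal (2 ^ n * Real.exp (-φ i (i.1.symm z)))).map i.1.symm

/-- The probability measure `μ_φ = e^{-φ} / ∫ e^{-φ}`. -/
def canonicalProbability [MeasurableSpace X] (φ : atlas (Model n) X → X → ℝ) :
    MeasureTheory.Measure X :=
  (canonicalVolume φ Set.univ)⁻¹ • canonicalVolume φ

/-- `𝓛(φ) = - log ∫ e^{-φ}`. -/
def logVolume [MeasurableSpace X] (φ : atlas (Model n) X → X → ℝ) : ℝ :=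
  -Real.log (canonicalVolume φ Set.univ).toReal

/-- The quantized Monge-Ampère energy `-(1 / (k N)) log det (H · Href⁻¹)`, with reference form
`Href`; the determinant is computed in the basis `b`, and does not depend on it. -/
def quantizedEnergy {k N : ℕ} (b : Module.Basis (Fin N) ℂ (H0 n X k))
    (Href H : SesqForm (H0 n X k)) : ℝ :=
  -(1 / ((k : ℝ) * N)) * Real.log (gram b H * (gram b Href)⁻¹).det.re

/-- The quantized Ding functional `𝓓^(k) = -𝓔^(k) + 𝓛 ∘ FS_k`. -/
def quantizedDing [MeasurableSpace X] {k N : ℕ} (b : Module.Basis (Fin N) ℂ (H0 n X k))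
    (Href H : SesqForm (H0 n X k)) : ℝ :=
  -quantizedEnergy b Href H + logVolume (fubiniStudyWeight H)

/-- The quantized Ding functional on the space of hermitian forms on `H⁰(X, -k K_X)`, in the
parametrisation of this space by the cone of positive definite matrices defined by the basis `s`:
the function `g gᴴ ↦ 𝓓^(k)(H_g)`. -/
def dingOnCone [MeasurableSpace X] {k N : ℕ} (s : Module.Basis (Fin N) ℂ (H0 n X k))
    (Href : SesqForm (H0 n X k)) (G : HermMat N) : ℝ :=
  quantizedDing s Href (formOf s G.1)

end Ding

/-! ### Projective space: moment map, vector fields, Fubini-Study metric -/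

section ProjectiveSpace

variable {N : ℕ}

/-- `ℂ^N` with its standard hermitian inner product. -/
abbrev Vec (N : ℕ) : Type := EuclideanSpace ℂ (Fin N)

/-- `ℂℙ^{N-1}`. -/
abbrev CP (N : ℕ) : Type := ℙ ℂ (Vec N)

/-- The matrix `(conj Z_α · Z_β / ∑ |Z_i|²)`. -/
def momentMatrix (Z : Vec N) : Matrix (Fin N) (Fin N) ℂ :=
  Matrix.of fun α β => (starRingEnd ℂ (Z α) * Z β) / (∑ i, (‖Z i‖ : ℂ) ^ 2)

theorem momentMatrix_smul (c : ℂ) (hc : c ≠ 0) (Z : Vec N) :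
    momentMatrix (c • Z) = momentMatrix Z := by
  have h : (starRingEnd ℂ c * c) ≠ 0 := mul_ne_zero (by simpa using hc) hc
  ext α β
  have e : (∑ i, (‖(c • Z) i‖ : ℂ) ^ 2) = (starRingEnd ℂ c * c) * ∑ i, (‖Z i‖ : ℂ) ^ 2 := by
    simp [mul_pow, Finset.mul_sum, ← Complex.conj_mul']
  simp only [momentMatrix, Matrix.of_apply, e]
  rw [← mul_div_mul_left _ (∑ i, (‖Z i‖ : ℂ) ^ 2) h]
  simp only [PiLp.smul_apply, smul_eq_mul, map_mul]
  ring

/-- The map `M : [Z] ↦ (conj Z_α · Z_β / ∑ |Z_i|²)` from `ℂℙ^{N-1}` to hermitian matrices. -/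
def momentMap : CP N → Matrix (Fin N) (Fin N) ℂ :=
  Projectivization.lift (fun Z => momentMatrix Z.1) (by
    rintro ⟨Z, hZ⟩ ⟨W, hW⟩ c (h : Z = c • W)
    have hc : c ≠ 0 := by rintro rfl; exact hZ (by simpa using h)
    simp only [h, momentMatrix_smul c hc])

/-- The function `H(A) = tr (A M)` on `ℂℙ^{N-1}`; it is real valued for hermitian `A`. -/
def hamiltonian (A : HermMat N) (p : CP N) : ℝ := (A.1 * momentMap p).trace.re

/-- The holomorphic tangent space of `ℂℙ^{N-1}` at the line `ℓ`, which is `Hom(ℓ, ℂ^N / ℓ)`.  The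
derivative at `Z ≠ 0` of the projection `ℂ^N ∖ {0} → ℂℙ^{N-1}` maps the tangent vector `w ∈ ℂ^N` to
the homomorphism with `Z ↦ w mod ℓ`. -/
abbrev TangentCP (p : CP N) : Type := p.submodule →ₗ[ℂ] (Vec N ⧸ p.submodule)

/-- The holomorphic vector field `ξ_A` on `ℂℙ^{N-1}`, the image of the linear vector field
`∑ A i j Z_i ∂/∂Z_j`, i.e. `Z ↦ Aᵀ Z`, on `ℂ^N ∖ {0}`. -/
def xi (A : HermMat N) (p : CP N) : TangentCP p :=
  p.submodule.mkQ ∘ₗ (Matrix.toEuclideanLin (A.1ᵀ)) ∘ₗ p.submodule.subtype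

/-- The isomorphism of `ℂ^N / ℓ` with the orthogonal complement of `ℓ`, as a map to `ℂ^N`. -/
def orthLift (p : CP N) : (Vec N ⧸ p.submodule) →ₗ[ℂ] Vec N :=
  p.submodule.liftQ (p.submoduleᗮ.starProjection : Vec N →L[ℂ] Vec N).toLinearMap (by
    intro v hv
    simpa [Submodule.starProjection_orthogonal', sub_eq_zero] using
      (Submodule.starProjection_eq_self_iff.2 hv).symm)

/-- The Fubini-Study hermitian inner product on the holomorphic tangent space at `ℓ`, complex linear
in `η`: on `Hom(ℓ, ℂ^N / ℓ) ≅ Hom(ℓ, ℓᗮ)` it is `⟨η(Z), ζ(Z)⟩ / |Z|²` for any `0 ≠ Z ∈ ℓ`, that is,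
the Kähler metric with components `∂_i ∂_j̄ log |Z|²`. -/
def fsInner (p : CP N) (η ζ : TangentCP p) : ℂ :=
  let Z : p.submodule := ⟨p.rep, by
    rw [Projectivization.submodule_eq]
    exact Submodule.mem_span_singleton_self _⟩
  inner ℂ (orthLift p (ζ Z)) (orthLift p (η Z)) / (‖(Z : Vec N)‖ : ℂ) ^ 2

/-- The Fubini-Study form `ω_FS = (√-1 / 2π) ∂∂̄ log |Z|²`, on real tangent vectors. The real tangent
space is identified with the holomorphic one by `v ↦ (v - √-1 J v) / 2`, so that `J` is
multiplication by `√-1`, and the velocity at `t = 0` of the curve `t ↦ [Z + t w]` is the homomorphism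
with `Z ↦ w mod ℓ`. -/
def fsForm (p : CP N) (u v : TangentCP p) : ℝ := -(1 / Real.pi) * (fsInner p u v).im

/-- The real vector field `ξ_A^ℝ` with `ξ_A = ξ_A^ℝ - √-1 J ξ_A^ℝ`. In the identification of real
with holomorphic tangent vectors made in `fsForm`, it is `ξ_A / 2`. -/
def xiReal (A : HermMat N) (p : CP N) : TangentCP p := (1 / 2 : ℂ) • xi A p

end ProjectiveSpace

/-! ### The embedding defined by a basis of sections -/

section Embedding

variable {n : ℕ} {X : Type*} [TopologicalSpace X] [ChartedSpace (Model n) X]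
  [IsManifold 𝓘(ℂ, Model n) ω X] {k N : ℕ}

/-- The values at `x` of the sections `s₁, …, s_N`, written in a trivialisation of `-k K_X` near
`x`. -/
def homogeneousCoords (s : Module.Basis (Fin N) ℂ (H0 n X k)) (x : X) : Vec N :=
  WithLp.toLp 2 fun j => coeff (achart (Model n) x) (s j) x

theorem coeff_achart (σ : H0 n X k) (x : X) : coeff (achart (Model n) x) σ x = σ x :=
  (anticanonicalCore n X k).coordChange_self (achart (Model n) x) x (mem_chart_source (Model n) x) (σ x)

theorem homogeneousCoords_ne_zero (s : Module.Basis (Fin N) ℂ (H0 n X k))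
    (h : ∀ x : X, ∃ σ : H0 n X k, σ x ≠ 0) (x : X) : homogeneousCoords s x ≠ 0 := by
  intro h0
  obtain ⟨σ, hσ⟩ := h x
  apply hσ
  have hs : ∀ j, (s j) x = 0 := fun j => by
    rw [← coeff_achart]
    exact congrFun (congrArg WithLp.ofLp h0) j
  rw [← s.sum_repr σ]
  have : ∀ t : Finset (Fin N), (∑ i ∈ t, s.repr σ i • s i : H0 n X k) x = 0 := by
    intro t
    induction t using Finset.induction_on with
    | empty => rfl
    | insert a t ha ih =>
      rw [Finset.sum_insert ha, ContMDiffSection.coe_add, Pi.add_apply, ih, add_zero,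
        ContMDiffSection.coe_smul, Pi.smul_apply, hs, smul_zero]
  exact this _

/-- The map `x ↦ [s₁(x) : ⋯ : s_N(x)]` to `ℂℙ^{N-1}`, for a base point free `-k K_X`. -/
def kodairaMap (s : Module.Basis (Fin N) ℂ (H0 n X k))
    (h : ∀ x : X, ∃ σ : H0 n X k, σ x ≠ 0) (x : X) : CP N :=
  Projectivization.mk ℂ (homogeneousCoords s x) (homogeneousCoords_ne_zero s h x)

end Embedding

end

end QuantizedDing

open QuantizedDing

namespace QuantizedDing

/-! ### Linear algebra of the moment map and the Fubini-Study metric -/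

section Projective

variable {N : ℕ}

/-! Parametrise hermitian forms by positive definite `G`, with `G = 1` at the base point. The dual
norm of evaluation at `x` for the form with Gram matrix `G⁻¹` is computed by Cauchy-Schwarz
(`iSup_sq_norm_dotProduct`): the supremum of `|s|²/H(s,s)` is `|Z|² tr(G M)`, where `Z` are the
coordinates of `x`. So passing from `1` to `G` multiplies the density `e^{-φ}` by the global
function `tr(G M)^{-1/k}`, and near `1` the functional is, up to a constant, `-(1/(kN)) log det G -
log I(G)` with `I(G) = ∫ tr(G M)^r dν`, `r = -1/k`, for one fixed finite measure `ν`
(`dingOnCone_eventuallyEq`).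

The term `log det` is affine along geodesics and has zero Hessian (`hessian_log_hermDet`). As `tr(G
M)` is linear in `G` and equals `1` at the base point, differentiating under the integral gives
`DI(A) = r ∫ H(A)` and `D²I(A,B) = r(r-1) ∫ H(A)H(B)`. The connection contributes `-(1/k)` times the
mean of `H(Γ(A,B))`, where `Γ(A,B) = -(AB+BA)/2`.

What remains is pointwise linear algebra on projective space: the Fubini-Study product of `ξ_A` and
`ξ_B` is a covariance, with real part `-H(Γ(A,B)) - H(A)H(B)` (`fsInner_xi_re`). Since `r(r-1) =
1/k² + 1/k`, the `1/k` part of the second derivative combines with the connection term into `k⁻¹ ∫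
Re(ξ_A, ξ_B)`. The Hamiltonian property is the quotient rule for the Rayleigh quotient `tr(A M)`. -/

theorem sum_norm_sq_eq (Z : Vec N) : (∑ i, (‖Z i‖ : ℂ) ^ 2) = (‖Z‖ : ℂ) ^ 2 := by
  rw [← Complex.ofReal_pow, EuclideanSpace.norm_sq_eq]
  push_cast
  rfl

/-- A Rayleigh quotient. The transpose appears because `ξ_A` lifts to `Z ↦ Aᵀ Z`, so the same vector
`Aᵀ Z` enters both the Hamiltonian and the Fubini-Study product. -/
theorem trace_mul_momentMatrix (A : Matrix (Fin N) (Fin N) ℂ) (Z : Vec N) :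
    (A * momentMatrix Z).trace =
      inner ℂ Z (Matrix.toEuclideanLin Aᵀ Z) / (‖Z‖ : ℂ) ^ 2 := by
  rw [← sum_norm_sq_eq]
  simp only [Matrix.trace, Matrix.diag, Matrix.mul_apply, momentMatrix, Matrix.of_apply,
    PiLp.inner_apply, Matrix.toLpLin_apply, Matrix.mulVec, dotProduct, RCLike.inner_apply,
    Matrix.transpose_apply, Finset.sum_mul, Finset.sum_div]
  rw [Finset.sum_comm]
  refine Finset.sum_congr rfl fun i _ => Finset.sum_congr rfl fun j _ => ?_
  ring

theorem inner_toEuclideanLin_transpose (A : HermMat N) (v w : Vec N) :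
    inner ℂ (Matrix.toEuclideanLin A.1ᵀ v) w = inner ℂ v (Matrix.toEuclideanLin A.1ᵀ w) := by
  have h : (A.1ᵀ)ᴴ = A.1ᵀ := by
    have hA : A.1ᴴ = A.1 := A.2
    conv_rhs => rw [← hA]
    rfl
  rw [← LinearMap.adjoint_inner_right, ← Matrix.toEuclideanLin_conjTranspose_eq_adjoint, h]

theorem trace_mul_momentMatrix_im (A : HermMat N) (Z : Vec N) :
    (A.1 * momentMatrix Z).trace.im = 0 := by
  rw [trace_mul_momentMatrix, ← Complex.ofReal_pow, Complex.div_ofReal_im]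
  have h := inner_conj_symm (𝕜 := ℂ) Z (Matrix.toEuclideanLin A.1ᵀ Z)
  rw [inner_toEuclideanLin_transpose] at h
  rw [Complex.conj_eq_iff_im.1 h, zero_div]

theorem ne_zero_eq_span {p : CP N} {Z : Vec N} (hZ : Z ∈ p.submodule) (h0 : Z ≠ 0) :
    p = Projectivization.mk ℂ Z h0 := by
  rw [Projectivization.submodule_eq, Submodule.mem_span_singleton] at hZ
  obtain ⟨c, rfl⟩ := hZ
  conv_lhs => rw [← p.mk_rep]
  exact ((Projectivization.mk_eq_mk_iff' ℂ _ _ h0 p.rep_nonzero).2 ⟨c, rfl⟩).symm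

theorem hamiltonian_eq (A : HermMat N) {p : CP N} {Z : Vec N} (hZ : Z ∈ p.submodule)
    (h0 : Z ≠ 0) : hamiltonian A p = (A.1 * momentMatrix Z).trace.re := by
  rw [ne_zero_eq_span hZ h0]
  rfl

theorem rep_mem_submodule (p : CP N) : p.rep ∈ p.submodule := by
  rw [Projectivization.submodule_eq]
  exact Submodule.mem_span_singleton_self _

/-- Rescaling `Z` by `c` multiplies numerator and denominator by `|c|²`, so the chosen
representative `p.rep` can be replaced by any nonzero vector of the line. -/
theorem fsInner_eq {p : CP N} (η ζ : TangentCP p) {Z : p.submodule} (h0 : Z ≠ 0) :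
    fsInner p η ζ =
      inner ℂ (orthLift p (ζ Z)) (orthLift p (η Z)) / (‖(Z : Vec N)‖ : ℂ) ^ 2 := by
  obtain ⟨c, hc⟩ : ∃ c : ℂ, Z = c • (⟨p.rep, rep_mem_submodule p⟩ : p.submodule) := by
    obtain ⟨c, hc⟩ := Submodule.mem_span_singleton.1 (p.submodule_eq.le Z.2)
    exact ⟨c, Subtype.ext hc.symm⟩
  have hc0 : c ≠ 0 := by
    rintro rfl
    exact h0 (by rw [hc, zero_smul])
  have hn : ((‖c‖ : ℂ)) ^ 2 ≠ 0 := by simpa using hc0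
  rw [hc]
  simp only [fsInner, map_smul, Submodule.coe_smul, norm_smul, inner_smul_left, inner_smul_right,
    Complex.ofReal_mul, mul_pow]
  rw [← mul_assoc, mul_comm c, Complex.conj_mul', mul_div_mul_left _ _ hn]

theorem inner_orthLift (p : CP N) (v w : Vec N) :
    inner ℂ (orthLift p (p.submodule.mkQ v)) (orthLift p (p.submodule.mkQ w)) =
      inner ℂ v (p.submoduleᗮ.starProjection w) := by
  change inner ℂ (p.submoduleᗮ.starProjection v) (p.submoduleᗮ.starProjection w) = _
  rw [Submodule.inner_starProjection_left_eq_right,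
    Submodule.starProjection_eq_self_iff.2 (Submodule.starProjection_apply_mem _ _)]

theorem submodule_eq_span {p : CP N} {Z : Vec N} (hZ : Z ∈ p.submodule) (h0 : Z ≠ 0) :
    p.submodule = ℂ ∙ Z := by
  rw [ne_zero_eq_span hZ h0, Projectivization.submodule_mk]

theorem starProjection_singleton_apply {p : CP N} {Z : Vec N} (hZ : Z ∈ p.submodule) (h0 : Z ≠ 0)
    (w : Vec N) :
    p.submodule.starProjection w = (inner ℂ Z w / (‖Z‖ : ℂ) ^ 2) • Z := by
  obtain ⟨c, hc⟩ : ∃ c : ℂ, c • Z = p.submodule.starProjection w :=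
    Submodule.mem_span_singleton.1
      ((submodule_eq_span hZ h0).le (Submodule.starProjection_apply_mem p.submodule w))
  have h1 : inner ℂ Z (p.submodule.starProjection w) = inner ℂ Z w := by
    rw [← Submodule.inner_starProjection_left_eq_right,
      Submodule.starProjection_eq_self_iff.2 hZ]
  have hn : ((‖Z‖ : ℂ)) ^ 2 ≠ 0 := by simpa using h0
  rw [← hc, inner_smul_right, inner_self_eq_norm_sq_to_K] at h1
  rw [← hc, ← h1]
  exact congrArg (· • Z) (mul_div_cancel_right₀ c hn).symm

/-- The projection to the orthogonal complement is the identity minus the projection to the line of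
`Z`. The result has the shape of a covariance, mean of a product minus product of means. -/
theorem fsInner_mkQ {p : CP N} {η ζ : TangentCP p} {Z : p.submodule} (h0 : Z ≠ 0) {v w : Vec N}
    (hη : η Z = p.submodule.mkQ v) (hζ : ζ Z = p.submodule.mkQ w) :
    fsInner p η ζ = inner ℂ w v / (‖(Z : Vec N)‖ : ℂ) ^ 2 -
      (inner ℂ w (Z : Vec N) / (‖(Z : Vec N)‖ : ℂ) ^ 2) *
        (inner ℂ (Z : Vec N) v / (‖(Z : Vec N)‖ : ℂ) ^ 2) := by
  have h0' : (Z : Vec N) ≠ 0 := by simpa using h0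
  rw [fsInner_eq η ζ h0, hη, hζ, inner_orthLift, Submodule.starProjection_orthogonal',
    sub_apply, starProjection_singleton_apply Z.2 h0', inner_sub_right,
    inner_smul_right]
  rw [show (1 : Vec N →L[ℂ] Vec N) v = v from rfl]
  ring

theorem xi_apply (A : HermMat N) (p : CP N) (Z : p.submodule) :
    xi A p Z = p.submodule.mkQ (Matrix.toEuclideanLin A.1ᵀ (Z : Vec N)) := rfl

/-- The real part of the Fubini-Study product of two fields `ξ_A`, `ξ_B`. -/
theorem fsInner_xi_re (A B : HermMat N) (p : CP N) :
    (fsInner p (xi A p) (xi B p)).re =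
      -hamiltonian (christoffel (idHerm N) A B) p - hamiltonian A p * hamiltonian B p := by
  have h0' : p.rep ≠ 0 := p.rep_nonzero
  set Z : p.submodule := ⟨p.rep, rep_mem_submodule p⟩ with hZ
  have h0 : Z ≠ 0 := fun h => h0' (congrArg Subtype.val h)
  -- At the identity the Christoffel symbol is `-(AB + BA)/2`.
  have hc : -hamiltonian (christoffel (idHerm N) A B) p =
      (1 / 2) * (((A.1 * B.1) * momentMatrix p.rep).trace.re
        + ((B.1 * A.1) * momentMatrix p.rep).trace.re) := by
    rw [hamiltonian_eq _ (rep_mem_submodule p) h0']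
    simp [christoffel, idHerm, Matrix.add_mul, mul_add]
  have hAB : ∀ A B : HermMat N, ((A.1 * B.1) * momentMatrix p.rep).trace.re =
      (inner ℂ (Matrix.toEuclideanLin B.1ᵀ p.rep) (Matrix.toEuclideanLin A.1ᵀ p.rep)
        / (‖p.rep‖ : ℂ) ^ 2).re := by
    intro A B
    rw [trace_mul_momentMatrix, inner_toEuclideanLin_transpose, Matrix.transpose_mul]
    simp [Matrix.toLpLin_apply]
  -- The two traces are complex conjugates of each other.
  have hsymm : ((B.1 * A.1) * momentMatrix p.rep).trace.re =
      ((A.1 * B.1) * momentMatrix p.rep).trace.re := by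
    rw [hAB, hAB, ← inner_conj_symm, ← Complex.ofReal_pow, Complex.div_ofReal_re,
      Complex.div_ofReal_re, Complex.conj_re]
  have hA := trace_mul_momentMatrix_im A p.rep
  have hB := trace_mul_momentMatrix_im B p.rep
  rw [fsInner_mkQ h0 (xi_apply A p Z) (xi_apply B p Z), hc, hsymm, hAB,
    hamiltonian_eq A (rep_mem_submodule p) h0', hamiltonian_eq B (rep_mem_submodule p) h0',
    Complex.sub_re, inner_toEuclideanLin_transpose B _ (Z : Vec N), ← trace_mul_momentMatrix,
    ← trace_mul_momentMatrix, Complex.mul_re, hA, hB]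
  simp only [hZ]
  ring

theorem fsInner_smul_left (p : CP N) (c : ℂ) (η ζ : TangentCP p) :
    fsInner p (c • η) ζ = c * fsInner p η ζ := by
  simp only [fsInner, LinearMap.smul_apply, map_smul, inner_smul_right, mul_div_assoc]

/-- `H(A)` is the Hamiltonian of `J ξ_A^ℝ`. -/
theorem hasDerivAt_trace_mul_momentMatrix (A : HermMat N) (p : CP N) (Z : p.submodule) (w : Vec N)
    (η : TangentCP p) (h0 : Z ≠ 0) (hη : η Z = p.submodule.mkQ w) :
    HasDerivAt (fun t : ℝ => (A.1 * momentMatrix ((Z : Vec N) + t • w)).trace.re)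
        (-(4 * Real.pi) * fsForm p (Complex.I • xiReal A p) η) 0 := by
  have h0' : (Z : Vec N) ≠ 0 := by simpa using h0
  set T := LinearMap.toContinuousLinearMap (Matrix.toEuclideanLin A.1ᵀ) with hT
  have hTa : ∀ v, Matrix.toEuclideanLin A.1ᵀ v = T v := fun v => rfl
  have hd : HasDerivAt (fun t : ℝ => (Z : Vec N) + t • w) w 0 := by
    simpa using ((hasDerivAt_id (0 : ℝ)).smul_const w).const_add (Z : Vec N)
  have hTd : HasDerivAt (fun t : ℝ => T ((Z : Vec N) + t • w)) (T w) 0 :=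
    ((T.restrictScalars ℝ).hasFDerivAt).comp_hasDerivAt (0 : ℝ) hd
  have hnum := Complex.reCLM.hasFDerivAt.comp_hasDerivAt (0 : ℝ) (hd.inner ℂ hTd)
  have hden : HasDerivAt (fun t : ℝ => ‖(Z : Vec N) + t • w‖ ^ 2)
      (2 * (inner ℂ w (Z : Vec N)).re) 0 := by
    have h := Complex.reCLM.hasFDerivAt.comp_hasDerivAt (0 : ℝ) (hd.inner ℂ hd)
    have hf : (fun t : ℝ => ‖(Z : Vec N) + t • w‖ ^ 2) = ⇑Complex.reCLM ∘
        fun t : ℝ => inner ℂ ((Z : Vec N) + t • w) ((Z : Vec N) + t • w) := by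
      funext t
      exact norm_sq_eq_re_inner (𝕜 := ℂ) _
    rw [hf]
    refine h.congr_deriv ?_
    rw [zero_smul, add_zero, Complex.reCLM_apply, Complex.add_re, ← inner_conj_symm,
      Complex.conj_re]
    ring
  have hne : ‖(Z : Vec N) + (0 : ℝ) • w‖ ^ 2 ≠ 0 := by simpa using h0'
  have hq := hnum.div hden hne
  have hfun : (fun t : ℝ => (A.1 * momentMatrix ((Z : Vec N) + t • w)).trace.re) =
      (⇑Complex.reCLM ∘ fun t : ℝ => inner ℂ ((Z : Vec N) + t • w) (T ((Z : Vec N) + t • w))) /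
        fun t : ℝ => ‖(Z : Vec N) + t • w‖ ^ 2 := by
    funext t
    rw [trace_mul_momentMatrix, ← Complex.ofReal_pow, Complex.div_ofReal_re]
    rfl
  rw [hfun]
  refine hq.congr_deriv ?_
  have hn : ‖(Z : Vec N)‖ ≠ 0 := by simpa using h0'
  -- Self-adjointness makes both halves of the derivative of the numerator contribute equally, which
  -- gives a factor `2`.
  have e1 : (inner ℂ (Z : Vec N) (T w)).re = (inner ℂ w (T (Z : Vec N))).re := by
    rw [← hTa, ← inner_toEuclideanLin_transpose, hTa, ← inner_conj_symm, Complex.conj_re]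
  have him : (inner ℂ (Z : Vec N) (T (Z : Vec N))).im = 0 := by
    have h := inner_conj_symm (𝕜 := ℂ) (Z : Vec N) (T Z)
    rw [← hTa, inner_toEuclideanLin_transpose] at h
    exact Complex.conj_eq_iff_im.1 h
  have hpi := Real.pi_ne_zero
  -- With `c = fsInner p (xi A p) η`, the constants give `-4π · (-1/π) · Im(i c / 2) = 2 Re c`,
  -- matching the factor `2` of the quotient rule.
  rw [fsForm, xiReal, fsInner_smul_left, fsInner_smul_left,
    fsInner_mkQ h0 (xi_apply A p Z) hη, hTa, ← Complex.ofReal_pow]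
  simp only [Complex.reCLM_apply, Function.comp_apply, zero_smul, add_zero, Complex.add_re, e1,
    Complex.mul_im, Complex.sub_re, Complex.sub_im, Complex.mul_re, Complex.div_ofReal_re,
    Complex.div_ofReal_im, Complex.I_re, Complex.I_im, him]
  norm_num
  field_simp
  ring

end Projective

/-! ### Integrals of powers of linear functions -/

section PowerIntegral

open MeasureTheory Filter Topology

universe u

variable {X : Type*} [MeasurableSpace X] {ν : Measure X}
  {E : Type u} [NormedAddCommGroup E] [NormedSpace ℝ E] {L : X → E →L[ℝ] ℝ}

/-- The function `G ↦ ∫ (L x G)^r • c x` of a parameter `G`. -/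
noncomputable def powerIntegral {F : Type*} [NormedAddCommGroup F] [NormedSpace ℝ F] (ν : Measure X)
    (L : X → E →L[ℝ] ℝ) (r : ℝ) (c : X → F) (G : E) : F :=
  ∫ x, (L x G) ^ r • c x ∂ν

theorem exists_rpow_bound {a b : ℝ} (ha : 0 < a) (r : ℝ) :
    ∃ K, ∀ t ∈ Set.Icc a b, |t ^ r| ≤ K := by
  have hc : ContinuousOn (fun t : ℝ => t ^ r) (Set.Icc a b) := fun t ht =>
    (Real.continuousAt_rpow_const t r (Or.inl (ha.trans_le ht.1).ne')).continuousWithinAt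
  exact isCompact_Icc.exists_bound_of_continuousOn hc

theorem aestronglyMeasurable_smulRight {F : Type*} [NormedAddCommGroup F] [NormedSpace ℝ F]
    (hL : AEStronglyMeasurable L ν) {c : X → F} (hc : AEStronglyMeasurable c ν) :
    AEStronglyMeasurable (fun x => (L x).smulRight (c x)) ν :=
  (ContinuousLinearMap.smulRightL ℝ E F).aestronglyMeasurable_comp₂ hL hc

theorem aestronglyMeasurable_rpow_smul {F : Type*} [NormedAddCommGroup F] [NormedSpace ℝ F]
    (hL : AEStronglyMeasurable L ν) {c : X → F} (hc : AEStronglyMeasurable c ν) (r : ℝ) (G : E) :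
    AEStronglyMeasurable (fun x => (L x G) ^ r • c x) ν := by
  have h1 : AEStronglyMeasurable (fun x => L x G) ν :=
    (ContinuousLinearMap.apply ℝ ℝ G).continuous.comp_aestronglyMeasurable hL
  exact ((h1.aemeasurable.pow_const r).aestronglyMeasurable).smul hc

theorem integrable_rpow_smul [IsFiniteMeasure ν] {F : Type*} [NormedAddCommGroup F] [NormedSpace ℝ F]
    {a b D : ℝ} (ha : 0 < a) {G : E} (hG : ∀ x, L x G ∈ Set.Icc a b)
    (hL : AEStronglyMeasurable L ν) {c : X → F} (hc : AEStronglyMeasurable c ν)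
    (hD : ∀ x, ‖c x‖ ≤ D) (r : ℝ) : Integrable (fun x => (L x G) ^ r • c x) ν := by
  obtain ⟨K, hK⟩ := exists_rpow_bound (b := b) ha r
  refine Integrable.of_bound (aestronglyMeasurable_rpow_smul hL hc r G) (K * D)
    (Eventually.of_forall fun x => ?_)
  rw [norm_smul]
  exact mul_le_mul (hK _ (hG x)) (hD x) (norm_nonneg _)
    ((abs_nonneg _).trans (hK _ (hG x)))

/-- Differentiation under the integral; domination by a constant suffices because the values `L x G`
stay in a compact interval away from `0`. Allowing vector-valued coefficients makes the derivative
another power integral, with exponent `r - 1`. -/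
theorem hasFDerivAt_powerIntegral [IsFiniteMeasure ν] {F : Type*} [NormedAddCommGroup F] [NormedSpace ℝ F]
    {a b C D : ℝ} (ha : 0 < a) {S : Set E} (hS : IsOpen S)
    (hG : ∀ G ∈ S, ∀ x, L x G ∈ Set.Icc a b)
    (hL : AEStronglyMeasurable L ν) (hC : ∀ x, ‖L x‖ ≤ C)
    {c : X → F} (hc : AEStronglyMeasurable c ν) (hD : ∀ x, ‖c x‖ ≤ D) (r : ℝ) {G : E}
    (hGS : G ∈ S) :
    HasFDerivAt (powerIntegral ν L r c)
      (r • powerIntegral ν L (r - 1) (fun x => (L x).smulRight (c x)) G) G := by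
  obtain ⟨K, hK⟩ := exists_rpow_bound (b := b) ha (r - 1)
  have hm := aestronglyMeasurable_smulRight hL hc
  have key := hasFDerivAt_integral_of_dominated_of_fderiv_le (μ := ν)
    (F := fun G x => (L x G) ^ r • c x)
    (F' := fun G x => r • ((L x G) ^ (r - 1) • (L x).smulRight (c x)))
    (bound := fun _ => |r| * (K * (C * D))) (hS.mem_nhds hGS)
    (Eventually.of_forall fun G => aestronglyMeasurable_rpow_smul hL hc r G)
    (integrable_rpow_smul ha (hG G hGS) hL hc hD r)
    ((aestronglyMeasurable_rpow_smul hL hm (r - 1) G).const_smul r)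
    (Eventually.of_forall fun x G hG' => ?_) (integrable_const _)
    (Eventually.of_forall fun x G hG' => ?_)
  · rw [integral_smul] at key
    exact key
  · have hK0 := (abs_nonneg _).trans (hK _ (hG G hG' x))
    rw [norm_smul, norm_smul, ContinuousLinearMap.norm_smulRight_apply]
    exact mul_le_mul_of_nonneg_left (mul_le_mul (hK _ (hG G hG' x))
      (mul_le_mul (hC x) (hD x) (norm_nonneg _) ((norm_nonneg _).trans (hC x))) (by positivity) hK0)
      (norm_nonneg r)
  · have hpos : L x G ≠ 0 := (ha.trans_le (hG G hG' x).1).ne'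
    have h1 := (((L x).hasFDerivAt (x := G)).rpow_const (p := r) (Or.inl hpos)).smul_const (c x)
    refine h1.congr_fderiv ?_
    ext v
    simp [smul_smul, mul_assoc]

/-- Induction on `m`. Each derivative takes values in `E →L[ℝ] F`, so the induction hypothesis must
range over all target spaces `F`; keeping `E` and `F` in one universe makes this possible. -/
theorem contDiffOn_powerIntegral [IsFiniteMeasure ν] {a b C : ℝ} (ha : 0 < a) {S : Set E} (hS : IsOpen S)
    (hG : ∀ G ∈ S, ∀ x, L x G ∈ Set.Icc a b)
    (hL : AEStronglyMeasurable L ν) (hC : ∀ x, ‖L x‖ ≤ C) (m : ℕ) :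
    ∀ {F : Type u} [NormedAddCommGroup F] [NormedSpace ℝ F] {D : ℝ} {c : X → F}
      (_ : AEStronglyMeasurable c ν) (_ : ∀ x, ‖c x‖ ≤ D) (r : ℝ),
      ContDiffOn ℝ m (powerIntegral ν L r c) S := by
  induction m with
  | zero =>
    intro F _ _ D c hc hD r
    rw [Nat.cast_zero, contDiffOn_zero]
    exact fun G hGS => (hasFDerivAt_powerIntegral ha hS hG hL hC hc hD r
      hGS).continuousAt.continuousWithinAt
  | succ m ih =>
    intro F _ _ D c hc hD r
    have hd := fun G (hGS : G ∈ S) => hasFDerivAt_powerIntegral ha hS hG hL hC hc hD r hGS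
    push_cast
    rw [contDiffOn_succ_iff_fderiv_of_isOpen hS]
    refine ⟨fun G hGS => (hd G hGS).differentiableAt.differentiableWithinAt, by simp, ?_⟩
    have h := (ih (D := C * D) (aestronglyMeasurable_smulRight hL hc) (fun x => by
      rw [ContinuousLinearMap.norm_smulRight_apply]
      exact mul_le_mul (hC x) (hD x) (norm_nonneg _) ((norm_nonneg _).trans (hC x))) (r - 1))
    exact (h.const_smul r).congr fun G hGS => (hd G hGS).fderiv

end PowerIntegral

/-! ### Calculus of second derivatives -/

section Calculus

open Filter Topology

variable {E : Type*} [NormedAddCommGroup E] [NormedSpace ℝ E]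

theorem contDiffAt_two_eventually_differentiableAt {f : E → ℝ} {G : E} (hf : ContDiffAt ℝ 2 f G) :
    ∀ᶠ G' in 𝓝 G, DifferentiableAt ℝ f G' :=
  (hf.eventually (by simp)).mono fun _ h => h.differentiableAt (by simp)

theorem differentiableAt_fderiv_of_contDiffAt_two {f : E → ℝ} {G : E} (hf : ContDiffAt ℝ 2 f G) :
    DifferentiableAt ℝ (fderiv ℝ f) G :=
  (hf.fderiv_right (m := 1) (by norm_num)).differentiableAt (by simp)

theorem fderiv_fderiv_neg_log {f : E → ℝ} {G : E} (hf : ContDiffAt ℝ 2 f G) (h0 : f G ≠ 0)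
    (U V : E) :
    fderiv ℝ (fderiv ℝ fun G => -Real.log (f G)) G U V =
      -((f G)⁻¹ * fderiv ℝ (fderiv ℝ f) G U V)
        + ((f G) ^ 2)⁻¹ * (fderiv ℝ f G U * fderiv ℝ f G V) := by
  have hne : ∀ᶠ G' in 𝓝 G, f G' ≠ 0 := hf.continuousAt.eventually_ne h0
  have h1 : (fderiv ℝ fun G => -Real.log (f G)) =ᶠ[𝓝 G] fun G' => -((f G')⁻¹ • fderiv ℝ f G') := by
    filter_upwards [hne, contDiffAt_two_eventually_differentiableAt hf] with G' h1 h2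
    exact (h2.hasFDerivAt.log h1).neg.fderiv
  have hd := (hf.differentiableAt (by simp)).hasFDerivAt
  have h2 := ((((hasDerivAt_inv h0).comp_hasFDerivAt G hd)).smul
    (differentiableAt_fderiv_of_contDiffAt_two hf).hasFDerivAt).neg
  have h3 : fderiv ℝ (fun G' => -((f G')⁻¹ • fderiv ℝ f G')) G = _ := h2.fderiv
  rw [h1.fderiv_eq, h3]
  simp
  ring

theorem fderiv_fderiv_add {F F' : E → ℝ} {G : E}
    (hF : ContDiffAt ℝ 2 F G) (hF' : ContDiffAt ℝ 2 F' G) :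
    fderiv ℝ (fderiv ℝ fun G => F G + F' G) G =
      fderiv ℝ (fderiv ℝ F) G + fderiv ℝ (fderiv ℝ F') G := by
  have h1 : fderiv ℝ (fun G => F G + F' G) =ᶠ[𝓝 G] fun G' => fderiv ℝ F G' + fderiv ℝ F' G' := by
    filter_upwards [contDiffAt_two_eventually_differentiableAt hF,
      contDiffAt_two_eventually_differentiableAt hF'] with G' h1 h2
    exact fderiv_fun_add h1 h2
  rw [h1.fderiv_eq, fderiv_fun_add (differentiableAt_fderiv_of_contDiffAt_two hF)
      (differentiableAt_fderiv_of_contDiffAt_two hF')]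

theorem fderiv_const_mul_add (F : E → ℝ) (c d : ℝ) :
    fderiv ℝ (fun G => c * F G + d) = fun G' => c • fderiv ℝ F G' := by
  funext G'
  rw [fderiv_add_const]
  exact congrFun (fderiv_const_smul_field (𝕜 := ℝ) (f := F) c) G'

theorem fderiv_fderiv_const_mul_add (F : E → ℝ) (c d : ℝ) (G : E) :
    fderiv ℝ (fderiv ℝ fun G => c * F G + d) G = c • fderiv ℝ (fderiv ℝ F) G := by
  rw [fderiv_const_mul_add]
  exact congrFun (fderiv_const_smul_field (𝕜 := ℝ) (f := fderiv ℝ F) c) G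

end Calculus

/-! ### The logarithm of the determinant -/

section LogDet

open Filter Topology

/-- The space of hermitian matrices, with the structure of a normed space only. -/
def HermSpace (N : ℕ) : Type := HermMat N

noncomputable instance (N : ℕ) : NormedAddCommGroup (HermSpace N) :=
  inferInstanceAs (NormedAddCommGroup (HermMat N))

noncomputable instance (N : ℕ) : NormedSpace ℝ (HermSpace N) :=
  inferInstanceAs (NormedSpace ℝ (HermMat N))

instance (N : ℕ) : FiniteDimensional ℝ (HermSpace N) :=
  inferInstanceAs (FiniteDimensional ℝ (HermMat N))

variable {N : ℕ}

/-- The identification of `HermSpace N` with the space of hermitian matrices. -/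
def HermSpace.toMat (G : HermSpace N) : HermMat N := G

/-- The identification of the space of hermitian matrices with `HermSpace N`. -/
def HermSpace.ofMat (G : HermMat N) : HermSpace N := G

/-- `HermSpace` is a synonym carrying the same norm, so both sides agree definitionally; all later
derivatives are taken on it. -/
theorem riemannianHessian_eq (F : HermMat N → ℝ) (G U V : HermMat N) :
    riemannianHessian F G U V =
      fderiv ℝ (fderiv ℝ fun G : HermSpace N => F G.toMat) (HermSpace.ofMat G) (HermSpace.ofMat U)
        (HermSpace.ofMat V) -
      fderiv ℝ (fun G : HermSpace N => F G.toMat) (HermSpace.ofMat G)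
        (HermSpace.ofMat (christoffel G U V)) := rfl

/-- The determinant of a hermitian matrix, a real number. -/
def hermDet (G : HermSpace N) : ℝ := G.toMat.1.det.re

theorem det_eq_hermDet (G : HermSpace N) : G.toMat.1.det = (hermDet G : ℂ) := by
  have h : G.toMat.1ᴴ = G.toMat.1 := G.toMat.2
  refine (Complex.conj_eq_iff_re.1 ?_).symm
  rw [starRingEnd_apply, ← Matrix.det_conjTranspose, h]

theorem contDiff_hermDet : ContDiff ℝ ω (hermDet (N := N)) := by
  have h : ∀ i j, ContDiff ℝ ω fun G : HermSpace N => G.toMat.1 i j :=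
    fun i j => by
      let l : HermSpace N →ₗ[ℝ] ℂ :=
        { toFun := fun G => G.toMat.1 i j
          map_add' := fun _ _ => rfl
          map_smul' := fun _ _ => rfl }
      exact (LinearMap.toContinuousLinearMap l).contDiff
  refine Complex.reCLM.contDiff.comp (g := fun z : ℂ => z.re) ?_
  simp only [Matrix.det_apply']
  exact ContDiff.sum fun σ _ => contDiff_const.mul (contDiff_prod fun i _ => h _ _)

theorem hermDet_idHerm : hermDet (HermSpace.ofMat (idHerm N)) = 1 := by
  simp [hermDet, idHerm, HermSpace.toMat, HermSpace.ofMat]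

theorem eventually_hermDet_pos : ∀ᶠ G in 𝓝 (HermSpace.ofMat (idHerm N)), 0 < hermDet G :=
  contDiff_hermDet.continuous.continuousAt.eventually (lt_mem_nhds (by simp [hermDet_idHerm]))

theorem contDiffAt_log_hermDet :
    ContDiffAt ℝ 2 (fun G : HermSpace N => Real.log (hermDet G)) (HermSpace.ofMat (idHerm N)) :=
  (contDiff_hermDet.contDiffAt.of_le le_top).log (by simp [hermDet_idHerm])

theorem hasDerivAt_det_one_add_smul (M : Matrix (Fin N) (Fin N) ℂ) :
    HasDerivAt (fun t : ℝ => (1 + (t : ℂ) • M).det) M.trace 0 := by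
  -- The determinant is a polynomial in `z`; dividing by `X` twice leaves the remainder `q` after
  -- the constant and linear terms, and `z² q(z)` has derivative `0` at `0`.
  set q := ((1 + (Polynomial.X : Polynomial ℂ) • M.map Polynomial.C).det).divX.divX with hq
  have hf : (fun z : ℂ => (1 + z • M).det) =
      fun z : ℂ => 1 + M.trace * z + q.eval z * z ^ 2 := by
    funext z
    rw [Matrix.det_one_add_smul]
  have h : HasDerivAt (fun z : ℂ => (1 + z • M).det) M.trace ((0 : ℝ) : ℂ) := by
    rw [hf]
    have h1 := (((hasDerivAt_id ((0 : ℝ) : ℂ)).const_mul M.trace).const_add 1).add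
      ((q.hasDerivAt ((0 : ℝ) : ℂ)).mul (hasDerivAt_pow 2 ((0 : ℝ) : ℂ)))
    exact h1.congr_deriv (by simp)
  exact h.comp_ofReal

/-- Jacobi's formula, from `det (G + tV) = det G · det (1 + t G⁻¹ V)`. -/
theorem fderiv_log_hermDet {G : HermSpace N} (hG : 0 < hermDet G) (V : HermSpace N) :
    fderiv ℝ (fun G : HermSpace N => Real.log (hermDet G)) G V =
      (G.toMat.1⁻¹ * V.toMat.1).trace.re := by
  have hdet : IsUnit G.toMat.1.det :=
    isUnit_iff_ne_zero.2 fun h => by simp [hermDet, h] at hG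
  have hd : DifferentiableAt ℝ (hermDet (N := N)) G := (contDiff_hermDet.differentiable (by simp)) G
  have h1 : fderiv ℝ hermDet G V =
      hermDet G * (G.toMat.1⁻¹ * V.toMat.1).trace.re := by
    rw [← hd.lineDeriv_eq_fderiv]
    refine HasLineDerivAt.lineDeriv ?_
    have h2 := (hasDerivAt_det_one_add_smul (G.toMat.1⁻¹ * V.toMat.1)).const_mul
      G.toMat.1.det
    have h3 := Complex.reCLM.hasFDerivAt.comp_hasDerivAt (0 : ℝ) h2
    have hf : (fun t : ℝ => hermDet (G + t • V)) = ⇑Complex.reCLM ∘ fun t : ℝ =>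
        G.toMat.1.det * (1 + (t : ℂ) • (G.toMat.1⁻¹ * V.toMat.1)).det := by
      funext t
      rw [Function.comp_apply, ← Matrix.det_mul, Matrix.mul_add, Matrix.mul_one, Matrix.mul_smul,
        Matrix.mul_nonsing_inv_cancel_left _ _ hdet, Complex.coe_smul]
      rfl
    rw [HasLineDerivAt, hf]
    refine h3.congr_deriv ?_
    rw [Complex.reCLM_apply, det_eq_hermDet, Complex.re_ofReal_mul]
  rw [(hd.hasFDerivAt.log hG.ne').fderiv, smul_apply, h1, smul_eq_mul,
    inv_mul_cancel_left₀ hG.ne']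

theorem fderiv_fderiv_log_hermDet (U V : HermMat N) :
    fderiv ℝ (fderiv ℝ fun G : HermSpace N => Real.log (hermDet G)) (HermSpace.ofMat (idHerm N))
      (HermSpace.ofMat U) (HermSpace.ofMat V) = -(U.1 * V.1).trace.re := by
  have hd := differentiableAt_fderiv_of_contDiffAt_two (contDiffAt_log_hermDet (N := N))
  set l := ContinuousLinearMap.apply ℝ ℝ (HermSpace.ofMat V)
  have h1 := (l.hasFDerivAt.comp _ hd.hasFDerivAt).hasLineDerivAt (HermSpace.ofMat U)
  -- The second derivative is found as the derivative at `t = 0` of `t ↦ tr((1 + tU)⁻¹ V)`, the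
  -- first derivative along a line.
  refine HasDerivAt.unique (𝕜 := ℝ) (x := 0) h1 ?_
  have h2 : HasDerivAt (fun t : ℝ => (1 + t • U.1)⁻¹) (-U.1) 0 := by
    have hr := hasFDerivAt_ringInverse (𝕜 := ℝ) (1 : (Matrix (Fin N) (Fin N) ℂ)ˣ)
    have h0 : HasDerivAt (fun t : ℝ => (1 : Matrix (Fin N) (Fin N) ℂ) + t • U.1) U.1 0 := by
      have h := ((hasDerivAt_id (0 : ℝ)).smul_const U.1).const_add (1 : Matrix (Fin N) (Fin N) ℂ)
      rw [one_smul] at h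
      exact h
    have hr' : HasFDerivAt Ring.inverse
        (-((ContinuousLinearMap.mulLeftRight ℝ (Matrix (Fin N) (Fin N) ℂ)) 1) 1)
        ((1 : Matrix (Fin N) (Fin N) ℂ) + (0 : ℝ) • U.1) := by simpa using hr
    have hc := hr'.comp_hasDerivAt (0 : ℝ) h0
    have hd : (-((ContinuousLinearMap.mulLeftRight ℝ (Matrix (Fin N) (Fin N) ℂ)) 1) 1) U.1
        = -U.1 := by simp
    rw [hd] at hc
    simp only [Matrix.nonsing_inv_eq_ringInverse]
    exact hc
  let T : Matrix (Fin N) (Fin N) ℂ →L[ℝ] ℝ :=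
    LinearMap.toContinuousLinearMap
      (Complex.reLm ∘ₗ (Matrix.traceLinearMap (Fin N) ℝ ℂ))
  have h3 := T.hasFDerivAt.comp_hasDerivAt (0 : ℝ) (h2.mul_const V.1)
  have h4 : T (-U.1 * V.1) = -(U.1 * V.1).trace.re := by
    rw [Matrix.neg_mul, map_neg]
    rfl
  refine (h3.congr_deriv h4).congr_of_eventuallyEq ?_
  have hc : Tendsto (fun t : ℝ => (HermSpace.ofMat (idHerm N)) + t • (HermSpace.ofMat U)) (𝓝 0)
      (𝓝 (HermSpace.ofMat (idHerm N))) := by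
    have h : Continuous fun t : ℝ => (HermSpace.ofMat (idHerm N)) + t • (HermSpace.ofMat U) := by fun_prop
    have h' := h.tendsto 0
    rwa [zero_smul, add_zero] at h'
  filter_upwards [hc.eventually eventually_hermDet_pos] with t ht
  exact fderiv_log_hermDet ht V

/-- `log det` is affine along geodesics. -/
theorem hessian_log_hermDet (U V : HermMat N) :
    fderiv ℝ (fderiv ℝ fun G : HermSpace N => Real.log (hermDet G)) (HermSpace.ofMat (idHerm N))
        (HermSpace.ofMat U) (HermSpace.ofMat V) =
      fderiv ℝ (fun G : HermSpace N => Real.log (hermDet G)) (HermSpace.ofMat (idHerm N))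
        (HermSpace.ofMat (christoffel (idHerm N) U V)) := by
  have htr : (V.1 * U.1).trace = (U.1 * V.1).trace := Matrix.trace_mul_comm _ _
  -- Both sides are `-Re tr(UV)`, the right one because the Christoffel symbol at the identity is
  -- `-(UV + VU)/2`.
  rw [fderiv_fderiv_log_hermDet, fderiv_log_hermDet eventually_hermDet_pos.self_of_nhds]
  simp only [HermSpace.toMat, HermSpace.ofMat, christoffel, idHerm, inv_one, one_mul, mul_one]
  simp [htr]
  ring

end LogDet

/-! ### Sections in charts -/

section Coefficients

variable {n : ℕ} {X : Type*} [TopologicalSpace X] [ChartedSpace (Model n) X]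
  [IsManifold 𝓘(ℂ, Model n) ω X] {k N : ℕ}

/-- The determinant of the Jacobian matrix of the change of charts from `i` to `j`. -/
noncomputable def jacobianDet (i j : atlas (Model n) X) (x : X) : ℂ :=
  ((tangentBundleCore 𝓘(ℂ, Model n) X).coordChange i j x).det

theorem coeff_eq (i : atlas (Model n) X) (s : H0 n X k) (x : X) :
    coeff i s x = (anticanonicalCore n X k).coordChange (achart (Model n) x) i x (s x) := rfl

theorem coeff_change {i j : atlas (Model n) X} (s : H0 n X k) {x : X} (hi : x ∈ i.1.source)
    (hj : x ∈ j.1.source) : coeff j s x = jacobianDet i j x ^ k * coeff i s x :=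
  ((anticanonicalCore n X k).coordChange_comp (achart (Model n) x) i j x
    ⟨⟨mem_chart_source _ x, hi⟩, hj⟩ (s x)).symm

theorem jacobianDet_mul {i j : atlas (Model n) X} {x : X} (hi : x ∈ i.1.source)
    (hj : x ∈ j.1.source) : jacobianDet j i x * jacobianDet i j x = 1 := by
  have h : ((tangentBundleCore 𝓘(ℂ, Model n) X).coordChange j i x).comp
      ((tangentBundleCore 𝓘(ℂ, Model n) X).coordChange i j x) = ContinuousLinearMap.id ℂ _ := by
    ext1 v
    exact ((tangentBundleCore 𝓘(ℂ, Model n) X).coordChange_comp i j i x ⟨⟨hi, hj⟩, hi⟩ v).trans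
      ((tangentBundleCore 𝓘(ℂ, Model n) X).coordChange_self i x hi v)
  have h' := congrArg (fun f : Model n →L[ℂ] Model n => f.det) h
  refine Eq.trans ?_ (h'.trans ?_)
  · exact (LinearMap.det_comp _ _).symm
  · exact LinearMap.det_id

theorem jacobianDet_ne_zero {i j : atlas (Model n) X} {x : X} (hi : x ∈ i.1.source)
    (hj : x ∈ j.1.source) : jacobianDet i j x ≠ 0 :=
  right_ne_zero_of_mul_eq_one (jacobianDet_mul hi hj)

theorem continuousOn_coeff (i : atlas (Model n) X) (s : H0 n X k) :
    ContinuousOn (coeff i s) i.1.source := by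
  have hs : Continuous fun x : X => (⟨x, s x⟩ : Bundle.TotalSpace ℂ (anticanonicalCore n X k).Fiber) :=
    s.contMDiff.continuous
  have h : ContinuousOn (fun x : X => (anticanonicalCore n X k).localTriv i ⟨x, s x⟩) i.1.source :=
    ((anticanonicalCore n X k).localTriv i).continuousOn.comp hs.continuousOn
      fun x hx => (VectorBundleCore.mem_localTriv_source _ _ _).2 hx
  exact continuous_snd.comp_continuousOn h

/-- The coefficients at `x`, in the chart `i`, of the sections of a basis. -/
noncomputable def coordVec (s : Module.Basis (Fin N) ℂ (H0 n X k)) (i : atlas (Model n) X)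
    (x : X) : Vec N :=
  WithLp.toLp 2 fun j => coeff i (s j) x

theorem coordVec_change (s : Module.Basis (Fin N) ℂ (H0 n X k)) {i j : atlas (Model n) X} {x : X}
    (hi : x ∈ i.1.source) (hj : x ∈ j.1.source) :
    coordVec s j x = jacobianDet i j x ^ k • coordVec s i x := by
  ext l
  exact coeff_change (s l) hi hj

theorem continuousOn_coordVec (s : Module.Basis (Fin N) ℂ (H0 n X k)) (i : atlas (Model n) X) :
    ContinuousOn (coordVec s i) i.1.source :=
  (PiLp.continuous_toLp 2 _).comp_continuousOn
    (continuousOn_pi.2 fun j => continuousOn_coeff i (s j))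

theorem coordVec_ne_zero (s : Module.Basis (Fin N) ℂ (H0 n X k))
    (h : ∀ x : X, ∃ σ : H0 n X k, σ x ≠ 0) {i : atlas (Model n) X} {x : X}
    (hi : x ∈ i.1.source) : coordVec s i x ≠ 0 := by
  rw [coordVec_change s (i := achart (Model n) x) (mem_chart_source _ x) hi]
  exact smul_ne_zero (pow_ne_zero _ (jacobianDet_ne_zero (mem_chart_source _ x) hi))
    (homogeneousCoords_ne_zero s h x)

/-- Coordinate vectors from different charts are proportional, and the moment matrix ignores
scaling. Hence one fixed chart can be used on its whole source, as continuity requires. -/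
theorem momentMap_kodairaMap (s : Module.Basis (Fin N) ℂ (H0 n X k))
    (h : ∀ x : X, ∃ σ : H0 n X k, σ x ≠ 0) {i : atlas (Model n) X} {x : X}
    (hi : x ∈ i.1.source) : momentMap (kodairaMap s h x) = momentMatrix (coordVec s i x) := by
  rw [coordVec_change s (i := achart (Model n) x) (mem_chart_source _ x) hi,
    momentMatrix_smul _ (pow_ne_zero _ (jacobianDet_ne_zero (mem_chart_source _ x) hi))]
  rfl

theorem continuousAt_momentMatrix {Z : Vec N} (hZ : Z ≠ 0) : ContinuousAt momentMatrix Z := by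
  refine continuousAt_pi.2 fun α => continuousAt_pi.2 fun β => ?_
  have hc : ∀ j, Continuous fun Z : Vec N => Z j := fun j => (EuclideanSpace.proj j).continuous
  refine ContinuousAt.div ?_ ?_ ?_
  · exact ((Complex.continuous_conj.comp (hc α)).mul (hc β)).continuousAt
  · exact (continuous_finsetSum _ fun i _ =>
      (Complex.continuous_ofReal.comp (hc i).norm).pow 2).continuousAt
  · rw [sum_norm_sq_eq]
    simpa using hZ

theorem continuous_momentMap_kodairaMap (s : Module.Basis (Fin N) ℂ (H0 n X k))
    (h : ∀ x : X, ∃ σ : H0 n X k, σ x ≠ 0) :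
    Continuous fun x => momentMap (kodairaMap s h x) := by
  refine continuous_iff_continuousAt.2 fun x => ?_
  set i := achart (Model n) x
  have hi : x ∈ i.1.source := mem_chart_source _ x
  have h1 : ContinuousAt (fun y => momentMatrix (coordVec s i y)) x :=
    (continuousAt_momentMatrix (coordVec_ne_zero s h hi)).comp
      ((continuousOn_coordVec s i).continuousAt (i.1.open_source.mem_nhds hi))
  refine h1.congr ?_
  filter_upwards [i.1.open_source.mem_nhds hi] with y hy
  exact (momentMap_kodairaMap s h hy).symm

theorem coeff_eq_dotProduct (s : Module.Basis (Fin N) ℂ (H0 n X k)) (σ : H0 n X k)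
    (i : atlas (Model n) X) (x : X) :
    coeff i σ x = ⇑(coordVec s i x) ⬝ᵥ ⇑(s.repr σ) := by
  have hlin : ∃ l : H0 n X k →ₗ[ℂ] ℂ, ∀ σ, l σ = coeff i σ x :=
    ⟨{ toFun := fun σ => coeff i σ x
       map_add' := fun a b => by
        rw [coeff_eq, coeff_eq, coeff_eq, ContMDiffSection.coe_add]
        exact map_add _ _ _
       map_smul' := fun c a => by
        rw [coeff_eq, coeff_eq, ContMDiffSection.coe_smul]
        exact ((anticanonicalCore n X k).coordChange (achart (Model n) x) i x).map_smul c (a x) }, fun _ => rfl⟩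
  obtain ⟨l, hl⟩ := hlin
  rw [← hl]
  conv_lhs => rw [← s.sum_repr σ]
  rw [map_sum, dotProduct]
  refine Finset.sum_congr rfl fun j _ => ?_
  rw [map_smul, hl, smul_eq_mul, mul_comm]
  rfl

end Coefficients

/-! ### The Fubini-Study metric of a hermitian form -/

section FubiniStudy

open Filter Topology
open scoped ComplexOrder

variable {N : ℕ}

/-- If `‖G - 1‖ < 1` in operator norm, then `⟨w, G w⟩ ≥ (1 - ‖G - 1‖) ‖w‖² > 0` for `w ≠ 0`. -/
theorem eventually_posDef : ∀ᶠ G : HermSpace N in 𝓝 (HermSpace.ofMat (idHerm N)), G.toMat.1.PosDef := by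
  let T : HermSpace N →ₗ[ℝ] (Vec N →L[ℂ] Vec N) :=
    { toFun := fun G => Matrix.toEuclideanCLM (𝕜 := ℂ) G.toMat.1
      map_add' := fun a b => map_add (Matrix.toEuclideanCLM (n := Fin N) (𝕜 := ℂ)) a.toMat.1 b.toMat.1
      map_smul' := fun c a => by
        have h : (c • a).toMat.1 = (c : ℂ) • a.toMat.1 := by
          rw [Complex.coe_smul]
          rfl
        rw [h, map_smul]
        exact Complex.coe_smul (E := Vec N →L[ℂ] Vec N) c _ }
  have hT : Continuous T := T.continuous_of_finiteDimensional
  have h1 : T (HermSpace.ofMat (idHerm N)) = 1 := map_one (Matrix.toEuclideanCLM (n := Fin N) (𝕜 := ℂ))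
  have h2 : ∀ᶠ G in 𝓝 (HermSpace.ofMat (idHerm N)), T G ∈ Metric.ball (1 : Vec N →L[ℂ] Vec N) 1 := by
    refine hT.continuousAt.eventually (Metric.isOpen_ball.mem_nhds ?_)
    rw [h1]
    exact Metric.mem_ball_self one_pos
  filter_upwards [h2] with G hG
  refine Matrix.PosDef.of_dotProduct_mulVec_pos G.toMat.2 fun v hv => ?_
  set w : Vec N := WithLp.toLp 2 v with hw
  have hw0 : w ≠ 0 := fun h => hv (congrArg WithLp.ofLp h)
  have e : star v ⬝ᵥ (G.toMat.1 *ᵥ v) = inner ℂ w (T G w) := by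
    rw [dotProduct_comm]
    rfl
  rw [e]
  have him : (inner ℂ w (T G w)).im = 0 := by
    rw [← e]
    exact Matrix.IsHermitian.im_star_dotProduct_mulVec_self (𝕜 := ℂ) G.toMat.2 v
  have hre : 0 < (inner ℂ w (T G w)).re := by
    have h3 : inner ℂ w (T G w) = inner ℂ w w + inner ℂ w ((T G - 1) w) := by
      rw [sub_apply, inner_sub_right]
      simp
    have h4 : -(inner ℂ w ((T G - 1) w)).re < ‖w‖ ^ 2 := by
      calc -(inner ℂ w ((T G - 1) w)).re ≤ ‖inner ℂ w ((T G - 1) w)‖ :=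
            (neg_le_abs _).trans (Complex.abs_re_le_norm _)
        _ ≤ ‖w‖ * (‖T G - 1‖ * ‖w‖) := (norm_inner_le_norm _ _).trans
            (mul_le_mul_of_nonneg_left ((T G - 1).le_opNorm w) (norm_nonneg _))
        _ = ‖T G - 1‖ * ‖w‖ ^ 2 := by ring
        _ < 1 * ‖w‖ ^ 2 := by
            have : 0 < ‖w‖ := norm_pos_iff.2 hw0
            have hG' : ‖T G - 1‖ < 1 := by rwa [← dist_eq_norm]
            gcongr
        _ = ‖w‖ ^ 2 := one_mul _
    have h5 : (inner ℂ w w).re = ‖w‖ ^ 2 := inner_self_eq_norm_sq (𝕜 := ℂ) w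
    rw [h3, Complex.add_re, h5]
    linarith
  exact Complex.pos_iff.2 ⟨hre, him.symm⟩

/-- The supremum of a linear form over the unit sphere of a hermitian form. -/
theorem iSup_sq_norm_dotProduct {G : Matrix (Fin N) (Fin N) ℂ} (hG : G.PosDef) {ι : Type*}
    {r : ι → Fin N → ℂ} (hr : ∀ v, v ≠ 0 → ∃ i, r i = v) (hr0 : ∀ i, r i ≠ 0)
    {Z : Fin N → ℂ} (hZ : Z ≠ 0) :
    ⨆ i, ‖Z ⬝ᵥ r i‖ ^ 2 / (star (r i) ⬝ᵥ (G⁻¹ *ᵥ r i)).re = (Z ⬝ᵥ (G *ᵥ star Z)).re := by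
  have hdet : IsUnit G.det := hG.det_pos.ne'.isUnit
  -- The Riesz vector of `x ↦ Z ⬝ᵥ x` for the inner product with matrix `G⁻¹`; the supremum is
  -- attained there.
  set y := G *ᵥ star Z with hy
  have hZy : ∀ x, Z ⬝ᵥ x = star y ⬝ᵥ (G⁻¹ *ᵥ x) := by
    intro x
    rw [Matrix.dotProduct_mulVec, hy, Matrix.star_mulVec, star_star, hG.1.eq,
      Matrix.vecMul_vecMul, Matrix.mul_nonsing_inv _ hdet, Matrix.vecMul_one]
  have hGi : (G⁻¹).PosDef := hG.inv
  -- Factoring `G⁻¹` turns its form into the standard inner product of `B u` and `B v`, where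
  -- Cauchy-Schwarz applies.
  obtain ⟨B, hB⟩ : ∃ B : Matrix (Fin N) (Fin N) ℂ, G⁻¹ = Bᴴ * B := by
    open scoped MatrixOrder in
    exact CStarAlgebra.nonneg_iff_eq_star_mul_self.1 hGi.posSemidef.nonneg
  have hform : ∀ u v : Fin N → ℂ, star u ⬝ᵥ (G⁻¹ *ᵥ v) =
      inner ℂ (WithLp.toLp 2 (B *ᵥ u) : Vec N) (WithLp.toLp 2 (B *ᵥ v)) := by
    intro u v
    rw [hB, EuclideanSpace.inner_toLp_toLp, ← Matrix.mulVec_mulVec, Matrix.dotProduct_mulVec,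
      Matrix.star_mulVec, dotProduct_comm]
  have hyy : star y ⬝ᵥ (G⁻¹ *ᵥ y) = Z ⬝ᵥ y := (hZy y).symm
  have hpos : ∀ v, v ≠ 0 → 0 < (star v ⬝ᵥ (G⁻¹ *ᵥ v)).re := fun v hv =>
    (Complex.pos_iff.1 (hGi.dotProduct_mulVec_pos hv)).1
  have hy0 : y ≠ 0 := by
    intro h
    apply hZ
    have h' : G⁻¹ *ᵥ y = star Z := by
      rw [hy, Matrix.mulVec_mulVec, Matrix.nonsing_inv_mul _ hdet, Matrix.one_mulVec]
    rw [h, Matrix.mulVec_zero] at h'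
    rw [← star_star Z, ← h', star_zero]
  have hself : ∀ v, (star v ⬝ᵥ (G⁻¹ *ᵥ v)).re = ‖(WithLp.toLp 2 (B *ᵥ v) : Vec N)‖ ^ 2 := by
    intro v
    rw [hform]
    exact inner_self_eq_norm_sq (𝕜 := ℂ) _
  have hub : ∀ i, ‖Z ⬝ᵥ r i‖ ^ 2 / (star (r i) ⬝ᵥ (G⁻¹ *ᵥ r i)).re ≤ (Z ⬝ᵥ y).re := by
    intro i
    rw [div_le_iff₀ (hpos _ (hr0 i)), hZy, ← hyy, hself, hself, hform, ← mul_pow]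
    gcongr
    exact norm_inner_le_norm _ _
  obtain ⟨i, hi⟩ := hr y hy0
  have : Nonempty ι := ⟨i⟩
  refine le_antisymm (ciSup_le hub) ?_
  -- A real supremum needs a bounded family, so the upper bound is used here as well.
  refine le_ciSup_of_le ⟨_, Set.forall_mem_range.2 hub⟩ i ?_
  have hn : ‖Z ⬝ᵥ y‖ = (Z ⬝ᵥ y).re := by
    rw [← hyy, hself, hform, ← Complex.ofReal_inj, inner_self_eq_norm_sq_to_K]
    simp
  have hne : (Z ⬝ᵥ y).re ≠ 0 := by
    rw [← hyy]
    exact (hpos y hy0).ne'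
  rw [hi, hyy, hn, sq, mul_div_cancel_right₀ _ hne]

end FubiniStudy

/-! ### Densities and suprema of measures -/

section Measures

open MeasureTheory
open scoped ENNReal

variable {X : Type*} [MeasurableSpace X]

theorem withDensity_le_withDensity {μ ν : Measure X} (h : μ ≤ ν) (f : X → ℝ≥0∞) :
    μ.withDensity f ≤ ν.withDensity f :=
  Measure.le_iff.2 fun s hs => by
    rw [withDensity_apply f hs, withDensity_apply f hs]
    exact lintegral_mono' (Measure.restrict_mono le_rfl h) le_rfl

/-- As `0 < f < ∞`, multiplication by `f` is an order automorphism of measures, with inverse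
multiplication by `1/f`, and so commutes with suprema. -/
theorem withDensity_iSup {ι : Type*} (ν : ι → Measure X) {f : X → ℝ≥0∞} (hf : Measurable f)
    (h0 : ∀ x, f x ≠ 0) (hT : ∀ x, f x ≠ ⊤) :
    (⨆ i, ν i).withDensity f = ⨆ i, (ν i).withDensity f := by
  have hinv : ∀ μ : Measure X, (μ.withDensity f).withDensity f⁻¹ = μ := fun μ =>
    withDensity_inv_same hf (Filter.Eventually.of_forall h0) (Filter.Eventually.of_forall hT)
  have hinv' : ∀ μ : Measure X, (μ.withDensity f⁻¹).withDensity f = μ := fun μ => by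
    have h := withDensity_inv_same (μ := μ) hf.inv
      (Filter.Eventually.of_forall fun x => by simpa using hT x)
      (Filter.Eventually.of_forall fun x => by simpa using h0 x)
    rwa [show (fun x => (f⁻¹ x)⁻¹) = f from inv_inv f] at h
  refine le_antisymm ?_ (iSup_le fun i => withDensity_le_withDensity (le_iSup ν i) f)
  set ρ := ⨆ i, (ν i).withDensity f with hρ
  have h1 : ⨆ i, ν i ≤ ρ.withDensity f⁻¹ := iSup_le fun i => by
    rw [← hinv (ν i)]
    exact withDensity_le_withDensity (le_iSup (fun i => (ν i).withDensity f) i) _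
  calc (⨆ i, ν i).withDensity f ≤ (ρ.withDensity f⁻¹).withDensity f :=
        withDensity_le_withDensity h1 f
    _ = ρ := hinv' ρ

/-- The projection formula. Measurability of `T` is required only almost everywhere, since an
inverse chart is controlled only on its target. -/
theorem map_withDensity_mul_comp {Y : Type*} [MeasurableSpace Y] {μ : Measure Y} [SFinite μ] {T : Y → X}
    (hT : AEMeasurable T μ) {g : Y → ℝ≥0∞} (hg : AEMeasurable g μ) {f : X → ℝ≥0∞}
    (hf : Measurable f) :
    (μ.withDensity fun y => g y * f (T y)).map T = ((μ.withDensity g).map T).withDensity f := by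
  have hTg : AEMeasurable T (μ.withDensity g) := hT.mono_ac (withDensity_absolutelyContinuous _ _)
  have hTgf : AEMeasurable T (μ.withDensity fun y => g y * f (T y)) :=
    hT.mono_ac (withDensity_absolutelyContinuous _ _)
  have hmul : (μ.withDensity fun y => g y * f (T y)) = (μ.withDensity g).withDensity (f ∘ T) :=
    withDensity_mul₀ hg (hf.comp_aemeasurable hT)
  ext s hs
  rw [withDensity_apply _ hs, Measure.restrict_map_of_aemeasurable hTg hs,
    lintegral_map' hf.aemeasurable (hTg.mono_measure Measure.restrict_le_self),
    Measure.map_apply_of_aemeasurable hTgf hs, hmul, withDensity_apply']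
  rfl

end Measures

/-! ### The volume form of a Fubini-Study metric -/

section Weights

variable {n : ℕ} {X : Type*} [TopologicalSpace X] [ChartedSpace (Model n) X]
  [IsManifold 𝓘(ℂ, Model n) ω X] {k N : ℕ}

open scoped ComplexOrder

theorem re_dotProduct_mulVec_star (G : Matrix (Fin N) (Fin N) ℂ) (Z : Vec N) (hZ : Z ≠ 0) :
    (⇑Z ⬝ᵥ (G *ᵥ star ⇑Z)).re = ‖Z‖ ^ 2 * (G * momentMatrix Z).trace.re := by
  have hn : ‖Z‖ ^ 2 ≠ 0 := by simpa using hZ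
  rw [trace_mul_momentMatrix, ← Complex.ofReal_pow, Complex.div_ofReal_re, mul_div_cancel₀ _ hn]
  congr 1
  rw [Matrix.dotProduct_mulVec, ← Matrix.mulVec_transpose]
  rfl

/-- The weights of the Fubini-Study metric of the form given by a positive definite matrix. -/
theorem fubiniStudyWeight_formOf (s : Module.Basis (Fin N) ℂ (H0 n X k))
    (h : ∀ x : X, ∃ σ : H0 n X k, σ x ≠ 0) {G : HermMat N} (hG : G.1.PosDef)
    {i : atlas (Model n) X} {x : X} (hx : x ∈ i.1.source) :
    fubiniStudyWeight (formOf s G.1) i x = (1 / (k : ℝ)) * Real.log (((k : ℝ) ^ n)⁻¹ *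
      (‖coordVec s i x‖ ^ 2 * hamiltonian G (kodairaMap s h x))) := by
  have hZ := coordVec_ne_zero s h hx
  have hZ' : (⇑(coordVec s i x) : Fin N → ℂ) ≠ 0 := fun h0 => hZ (by ext j; exact congrFun h0 j)
  have hs := iSup_sq_norm_dotProduct hG (ι := {σ : H0 n X k // σ ≠ 0})
    (r := fun σ => ⇑(s.repr σ.1)) (fun v hv => ?_) (fun σ h0 => ?_) hZ'
  · rw [hamiltonian, momentMap_kodairaMap s h hx, ← re_dotProduct_mulVec_star _ _ hZ, ← hs]
    simp only [fubiniStudyWeight, coeff_eq_dotProduct s]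
    rfl
  · refine ⟨⟨s.equivFun.symm v, ?_⟩, ?_⟩
    · exact fun h0 => hv (s.equivFun.symm.map_eq_zero_iff.1 h0)
    · exact s.equivFun.apply_symm_apply v
  · refine σ.2 (s.repr.map_eq_zero_iff.1 ?_)
    exact DFunLike.coe_injective h0

theorem hamiltonian_pos {G : HermMat N} (hG : G.1.PosDef) (p : CP N) : 0 < hamiltonian G p := by
  have h0 := p.rep_nonzero
  rw [hamiltonian_eq G (rep_mem_submodule p) h0]
  have hn : 0 < ‖p.rep‖ ^ 2 := by positivity
  refine pos_of_mul_pos_right ?_ hn.le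
  rw [← re_dotProduct_mulVec_star _ _ h0]
  have h := (Complex.pos_iff.1 (hG.dotProduct_mulVec_pos (x := star ⇑p.rep) fun h1 => h0 (by
    ext j
    simpa using congrFun h1 j))).1
  rwa [star_star] at h

theorem hamiltonian_idHerm (p : CP N) : hamiltonian (idHerm N) p = 1 := by
  have h0 := p.rep_nonzero
  have hn : (‖p.rep‖ : ℂ) ^ 2 ≠ 0 := by simpa using h0
  rw [hamiltonian_eq _ (rep_mem_submodule p) h0, trace_mul_momentMatrix]
  have h1 : Matrix.toEuclideanLin (idHerm N).1ᵀ p.rep = p.rep := by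
    simp [idHerm]
  rw [h1, inner_self_eq_norm_sq_to_K]
  exact (congrArg Complex.re (div_self hn)).trans Complex.one_re

theorem posDef_idHerm : (idHerm N).1.PosDef := Matrix.PosDef.one

theorem exp_neg_fubiniStudyWeight_idHerm (hk : 0 < k) (s : Module.Basis (Fin N) ℂ (H0 n X k))
    (h : ∀ x : X, ∃ σ : H0 n X k, σ x ≠ 0) {i : atlas (Model n) X} {x : X}
    (hx : x ∈ i.1.source) :
    Real.exp (-fubiniStudyWeight (formOf s (idHerm N).1) i x) =
      (((k : ℝ) ^ n)⁻¹ * ‖coordVec s i x‖ ^ 2) ^ (-(1 / (k : ℝ))) := by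
  have hk' : (0 : ℝ) < k := by exact_mod_cast hk
  have hZ := norm_pos_iff.2 (coordVec_ne_zero s h hx)
  rw [fubiniStudyWeight_formOf s h posDef_idHerm hx, hamiltonian_idHerm, mul_one,
    Real.rpow_def_of_pos (by positivity)]
  congr 1
  ring

/-- The factor by which the density changes does not depend on the chart, so it becomes a density on
`X`. -/
theorem exp_neg_fubiniStudyWeight (hk : 0 < k) (s : Module.Basis (Fin N) ℂ (H0 n X k))
    (h : ∀ x : X, ∃ σ : H0 n X k, σ x ≠ 0) {G : HermMat N} (hG : G.1.PosDef)
    {i : atlas (Model n) X} {x : X} (hx : x ∈ i.1.source) :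
    Real.exp (-fubiniStudyWeight (formOf s G.1) i x) =
      Real.exp (-fubiniStudyWeight (formOf s (idHerm N).1) i x) *
        hamiltonian G (kodairaMap s h x) ^ (-(1 / (k : ℝ))) := by
  have hk' : (0 : ℝ) < k := by exact_mod_cast hk
  have hZ := norm_pos_iff.2 (coordVec_ne_zero s h hx)
  have hH := hamiltonian_pos hG (kodairaMap s h x)
  rw [exp_neg_fubiniStudyWeight_idHerm hk s h hx, ← Real.mul_rpow (by positivity) hH.le,
    fubiniStudyWeight_formOf s h hG hx, Real.rpow_def_of_pos (by positivity), mul_assoc]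
  congr 1
  ring

/-- The transformation rule of the weights of a Fubini-Study metric. -/
theorem exp_neg_fubiniStudyWeight_change (hk : 0 < k) (s : Module.Basis (Fin N) ℂ (H0 n X k))
    (h : ∀ x : X, ∃ σ : H0 n X k, σ x ≠ 0) {i j : atlas (Model n) X} {x : X}
    (hi : x ∈ i.1.source) (hj : x ∈ j.1.source) :
    ‖jacobianDet i j x‖ ^ 2 * Real.exp (-fubiniStudyWeight (formOf s (idHerm N).1) j x) =
      Real.exp (-fubiniStudyWeight (formOf s (idHerm N).1) i x) := by
  have hk' : (0 : ℝ) < k := by exact_mod_cast hk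
  have hJ := norm_pos_iff.2 (jacobianDet_ne_zero hi hj)
  rw [exp_neg_fubiniStudyWeight_idHerm hk s h hi, exp_neg_fubiniStudyWeight_idHerm hk s h hj,
    coordVec_change s hi hj, norm_smul, norm_pow]
  -- Coordinates scale by the `k`-th power of the Jacobian determinant; after squaring and taking
  -- the power `-1/k`, this leaves `|det|⁻²`.
  have e : ((k : ℝ) ^ n)⁻¹ * (‖jacobianDet i j x‖ ^ k * ‖coordVec s i x‖) ^ 2 =
      (‖jacobianDet i j x‖ ^ 2) ^ (k : ℝ) * (((k : ℝ) ^ n)⁻¹ * ‖coordVec s i x‖ ^ 2) := by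
    rw [Real.rpow_natCast]
    ring
  rw [e, Real.mul_rpow (by positivity) (by positivity), ← Real.rpow_mul (by positivity),
    show (k : ℝ) * -(1 / (k : ℝ)) = -1 by field_simp, Real.rpow_neg_one, ← mul_assoc,
    mul_inv_cancel₀ (by positivity), one_mul]

theorem continuousOn_exp_neg_fubiniStudyWeight (hk : 0 < k)
    (s : Module.Basis (Fin N) ℂ (H0 n X k))
    (h : ∀ x : X, ∃ σ : H0 n X k, σ x ≠ 0) (i : atlas (Model n) X) :
    ContinuousOn (fun x => Real.exp (-fubiniStudyWeight (formOf s (idHerm N).1) i x))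
      i.1.source := by
  have hk' : (0 : ℝ) < k := by exact_mod_cast hk
  have h1 : ContinuousOn
      (fun x => (((k : ℝ) ^ n)⁻¹ * ‖coordVec s i x‖ ^ 2) ^ (-(1 / (k : ℝ)))) i.1.source := by
    refine (continuousOn_const.mul ((continuousOn_coordVec s i).norm.pow 2)).rpow_const
      fun x hx => Or.inl ?_
    have hZ := norm_pos_iff.2 (coordVec_ne_zero s h hx)
    simp only [Pi.mul_apply, Pi.pow_apply]
    positivity
  exact h1.congr fun x hx => exp_neg_fubiniStudyWeight_idHerm hk s h hx

end Weights

/-! ### Chart measures and the effect of rescaling the metric -/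

section Volume

open MeasureTheory

variable {n : ℕ} {X : Type*} [TopologicalSpace X] [ChartedSpace (Model n) X]

theorem aemeasurable_chart_density {φ : atlas (Model n) X → X → ℝ} {i : atlas (Model n) X}
    (hφ : ContinuousOn (fun x => Real.exp (-φ i x)) i.1.source) :
    AEMeasurable (fun z => ENNReal.ofReal (2 ^ n * Real.exp (-φ i (i.1.symm z))))
      ((volume : Measure (Model n)).restrict i.1.target) := by
  have h : ContinuousOn (fun z => Real.exp (-φ i (i.1.symm z))) i.1.target :=
    hφ.comp i.1.continuousOn_symm fun z hz => i.1.map_target hz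
  exact ((continuousOn_const.mul h).aemeasurable i.1.open_target.measurableSet).ennreal_ofReal

variable [MeasurableSpace X]

/-- The measure defined in a chart by the volume form of a metric on `-K_X`. -/
noncomputable def chartVolume (φ : atlas (Model n) X → X → ℝ) (i : atlas (Model n) X) :
    Measure X :=
  (((volume : Measure (Model n)).restrict i.1.target).withDensity
      fun z => ENNReal.ofReal (2 ^ n * Real.exp (-φ i (i.1.symm z)))).map i.1.symm

theorem canonicalVolume_eq (φ : atlas (Model n) X → X → ℝ) :
    canonicalVolume φ = ⨆ i, chartVolume φ i := rfl

theorem aemeasurable_chart_symm [BorelSpace X] (i : atlas (Model n) X) :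
    AEMeasurable i.1.symm ((volume : Measure (Model n)).restrict i.1.target) :=
  i.1.continuousOn_symm.aemeasurable i.1.open_target.measurableSet

theorem chartVolume_apply [BorelSpace X] {φ : atlas (Model n) X → X → ℝ} {i : atlas (Model n) X} {E : Set X}
    (hE : MeasurableSet E) :
    chartVolume φ i E = ∫⁻ z in i.1.target ∩ i.1.symm ⁻¹' E,
      ENNReal.ofReal (2 ^ n * Real.exp (-φ i (i.1.symm z))) := by
  rw [chartVolume, Measure.map_apply_of_aemeasurable
    ((aemeasurable_chart_symm i).mono_ac (withDensity_absolutelyContinuous _ _)) hE,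
    withDensity_apply', Measure.restrict_restrict₀
      ((aemeasurable_chart_symm i).nullMeasurableSet_preimage hE), Set.inter_comm]

/-- Multiplying the volume form by a function. -/
theorem canonicalVolume_withDensity [BorelSpace X] {φ ψ : atlas (Model n) X → X → ℝ} {f : X → ℝ}
    (hf : Measurable f) (hpos : ∀ x, 0 < f x)
    (hφ : ∀ i, ContinuousOn (fun x => Real.exp (-φ i x)) i.1.source)
    (h : ∀ i : atlas (Model n) X, ∀ x ∈ i.1.source,
      Real.exp (-ψ i x) = Real.exp (-φ i x) * f x) :
    canonicalVolume ψ = (canonicalVolume φ).withDensity fun x => ENNReal.ofReal (f x) := by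
  rw [canonicalVolume_eq, canonicalVolume_eq, withDensity_iSup _ hf.ennreal_ofReal
    (fun x => by simpa using hpos x) (fun x => ENNReal.ofReal_ne_top)]
  refine iSup_congr fun i => ?_
  rw [chartVolume, chartVolume, ← map_withDensity_mul_comp (aemeasurable_chart_symm i)
    (aemeasurable_chart_density (hφ i)) hf.ennreal_ofReal]
  congr 1
  refine withDensity_congr_ae ?_
  filter_upwards [ae_restrict_mem i.1.open_target.measurableSet] with z hz
  rw [h i _ (i.1.map_target hz), ← mul_assoc, ENNReal.ofReal_mul (by positivity)]

end Volume

/-! ### Finiteness of the volume -/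

section Finiteness

open MeasureTheory

/-- The real determinant is the field norm from `ℂ` to `ℝ` of the complex one. It reconciles the
real change of variables with the factor `|det|²` in the weights. -/
theorem abs_det_restrictScalars {n : ℕ} (f : Model n →L[ℂ] Model n) :
    |(f.restrictScalars ℝ).det| = ‖f.det‖ ^ 2 := by
  have h : (f.restrictScalars ℝ).det = Algebra.norm ℝ f.det :=
    LinearMap.det_restrictScalars (f := (f : Model n →ₗ[ℂ] Model n))
  rw [h, Algebra.norm_complex_apply, Complex.normSq_eq_norm_sq, abs_of_nonneg (by positivity)]

variable {n : ℕ} {X : Type*} [TopologicalSpace X] [ChartedSpace (Model n) X]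

theorem hasFDerivAt_coordChange [IsManifold 𝓘(ℂ, Model n) ω X] {i j : atlas (Model n) X} {x : X} (hi : x ∈ i.1.source)
    (hj : x ∈ j.1.source) :
    HasFDerivAt (j.1 ∘ i.1.symm)
      ((tangentBundleCore 𝓘(ℂ, Model n) X).coordChange i j x) (i.1 x) := by
  have h1 : DifferentiableWithinAt ℂ
      (j.1.extend 𝓘(ℂ, Model n) ∘ (i.1.extend 𝓘(ℂ, Model n)).symm)
      (Set.range 𝓘(ℂ, Model n)) (i.1.extend 𝓘(ℂ, Model n) x) :=
    (ModelWithCorners.contDiffWithinAt_extendCoordChange' (n := ω) (I := 𝓘(ℂ, Model n))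
        (IsManifold.subset_maximalAtlas i.2) (IsManifold.subset_maximalAtlas j.2)
        hi hj).differentiableWithinAt (by simp)
  have h2 := h1.hasFDerivWithinAt
  simp only [modelWithCornersSelf_coe, Set.range_id, hasFDerivWithinAt_univ] at h2
  have h3 : (tangentBundleCore 𝓘(ℂ, Model n) X).coordChange i j x =
      fderivWithin ℂ (j.1.extend 𝓘(ℂ, Model n) ∘ (i.1.extend 𝓘(ℂ, Model n)).symm)
        (Set.range 𝓘(ℂ, Model n)) (i.1.extend 𝓘(ℂ, Model n) x) := rfl
  rw [h3]
  simpa using h2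

variable [MeasurableSpace X] [BorelSpace X]

/-- The measures defined in two charts by a volume form agree on the overlap. -/
theorem chartVolume_eq_of_subset [IsManifold 𝓘(ℂ, Model n) ω X]
    {φ : atlas (Model n) X → X → ℝ} {i j : atlas (Model n) X}
    (h : ∀ x, x ∈ i.1.source → x ∈ j.1.source →
      ‖jacobianDet i j x‖ ^ 2 * Real.exp (-φ j x) = Real.exp (-φ i x))
    {E : Set X} (hE : MeasurableSet E) (hi : E ⊆ i.1.source) (hj : E ⊆ j.1.source) :
    chartVolume φ i E = chartVolume φ j E := by
  rw [chartVolume_apply hE, chartVolume_apply hE]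
  have himg : ∀ l : atlas (Model n) X, E ⊆ l.1.source →
      l.1.target ∩ l.1.symm ⁻¹' E = l.1 '' E := fun l hl => by
    rw [l.1.image_eq_target_inter_inv_preimage hl]
  have hmeas : MeasurableSet (i.1.target ∩ i.1.symm ⁻¹' E) := by
    have h1 : Measurable (i.1.target.domRestrict i.1.symm) :=
      (continuousOn_iff_continuous_domRestrict.1 i.1.continuousOn_symm).measurable
    have h2 := i.1.open_target.measurableSet.subtype_image (h1 hE)
    rwa [Set.domRestrict_eq, Set.preimage_comp, Subtype.image_preimage_coe] at h2
  have hcomp : j.1.target ∩ j.1.symm ⁻¹' E =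
      (j.1 ∘ i.1.symm) '' (i.1.target ∩ i.1.symm ⁻¹' E) := by
    rw [himg i hi, himg j hj, Set.image_image]
    exact Set.image_congr fun x hx => by rw [Function.comp_apply, i.1.left_inv (hi hx)]
  have hinj : Set.InjOn (j.1 ∘ i.1.symm) (i.1.target ∩ i.1.symm ⁻¹' E) :=
    j.1.injOn.comp (i.1.symm.injOn.mono Set.inter_subset_left) fun z hz => hj hz.2
  have hd : ∀ z ∈ i.1.target ∩ i.1.symm ⁻¹' E, HasFDerivWithinAt (j.1 ∘ i.1.symm)
      (((tangentBundleCore 𝓘(ℂ, Model n) X).coordChange i j (i.1.symm z)).restrictScalars ℝ)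
      (i.1.target ∩ i.1.symm ⁻¹' E) z := fun z hz => by
    have h1 := hasFDerivAt_coordChange (hi hz.2) (hj hz.2)
    rw [i.1.right_inv hz.1] at h1
    exact (h1.restrictScalars ℝ).hasFDerivWithinAt
  rw [hcomp, lintegral_image_eq_lintegral_abs_det_fderiv_mul volume hmeas hd hinj]
  refine setLIntegral_congr_fun hmeas fun z hz => ?_
  rw [abs_det_restrictScalars, Function.comp_apply, j.1.left_inv (hj hz.2),
    ← ENNReal.ofReal_mul (by positivity), ← h _ (hi hz.2) (hj hz.2), jacobianDet]
  congr 1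
  ring

theorem chartVolume_compl_source (φ : atlas (Model n) X → X → ℝ) (i : atlas (Model n) X) :
    chartVolume φ i i.1.sourceᶜ = 0 := by
  have h : i.1.target ∩ i.1.symm ⁻¹' i.1.sourceᶜ = ∅ :=
    Set.eq_empty_of_forall_notMem fun z hz => hz.2 (i.1.map_target hz.1)
  rw [chartVolume_apply i.1.open_source.measurableSet.compl, h, Measure.restrict_empty,
    lintegral_zero_measure]

theorem exists_chartVolume_lt_top {φ : atlas (Model n) X → X → ℝ} {i : atlas (Model n) X}
    (hφ : ContinuousOn (fun x => Real.exp (-φ i x)) i.1.source) {x : X} (hx : x ∈ i.1.source) :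
    ∃ U, IsOpen U ∧ x ∈ U ∧ U ⊆ i.1.source ∧ chartVolume φ i U < ⊤ := by
  have hxt := i.1.map_source hx
  have hc : ContinuousAt (fun z => Real.exp (-φ i (i.1.symm z))) (i.1 x) :=
    (hφ.comp i.1.continuousOn_symm fun z hz => i.1.map_target hz).continuousAt
      (i.1.open_target.mem_nhds hxt)
  obtain ⟨r, hr, hball⟩ := Metric.eventually_nhds_iff_ball.1
    ((hc.eventually (gt_mem_nhds (lt_add_one _))).and (i.1.open_target.mem_nhds hxt))
  set C := Real.exp (-φ i (i.1.symm (i.1 x))) + 1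
  refine ⟨i.1.source ∩ i.1 ⁻¹' Metric.ball (i.1 x) r,
    i.1.isOpen_inter_preimage Metric.isOpen_ball, ⟨hx, Metric.mem_ball_self hr⟩,
    Set.inter_subset_left, ?_⟩
  rw [chartVolume_apply (i.1.isOpen_inter_preimage Metric.isOpen_ball).measurableSet]
  have hsub : i.1.target ∩ i.1.symm ⁻¹' (i.1.source ∩ i.1 ⁻¹' Metric.ball (i.1 x) r) ⊆
      Metric.ball (i.1 x) r := fun z hz => by
    have h := hz.2.2
    rwa [Set.mem_preimage, i.1.right_inv hz.1] at h
  refine (lintegral_mono_set hsub).trans_lt ?_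
  refine (setLIntegral_mono' (g := fun _ => ENNReal.ofReal (2 ^ n * C)) measurableSet_ball
    fun z hz => ?_).trans_lt ?_
  · exact ENNReal.ofReal_le_ofReal
      (mul_le_mul_of_nonneg_left (hball z hz).1.le (by positivity))
  · rw [setLIntegral_const]
    exact ENNReal.mul_lt_top ENNReal.ofReal_lt_top measure_ball_lt_top

/-- The atlas may be infinite, so the supremum is bounded by a finite sum: cover `X` by finitely
many open sets of finite chart volume. Agreement on overlaps puts every chart measure below the sum
of the measures of these pieces. -/
theorem canonicalVolume_univ_lt_top [IsManifold 𝓘(ℂ, Model n) ω X] [CompactSpace X]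
    {φ : atlas (Model n) X → X → ℝ}
    (hφ : ∀ i, ContinuousOn (fun x => Real.exp (-φ i x)) i.1.source)
    (h : ∀ (i j : atlas (Model n) X) x, x ∈ i.1.source → x ∈ j.1.source →
      ‖jacobianDet i j x‖ ^ 2 * Real.exp (-φ j x) = Real.exp (-φ i x)) :
    canonicalVolume φ Set.univ < ⊤ := by
  choose U hUo hxU hUs hUf using fun x : X =>
    exists_chartVolume_lt_top (hφ (achart (Model n) x)) (mem_chart_source (Model n) x)
  obtain ⟨t, ht⟩ := isCompact_univ.elim_finite_subcover U hUo
    fun x _ => Set.mem_iUnion.2 ⟨x, hxU x⟩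
  have hle : canonicalVolume φ ≤
      ∑ x ∈ t, (chartVolume φ (achart (Model n) x)).restrict (U x) := by
    rw [canonicalVolume_eq]
    refine iSup_le fun i => Measure.le_iff.2 fun E hE => ?_
    have hEi := hE.inter i.1.open_source.measurableSet
    have h1 : chartVolume φ i E = chartVolume φ i (E ∩ i.1.source) := by
      rw [← measure_inter_add_sdiff E i.1.open_source.measurableSet,
        measure_mono_null (s := E \ i.1.source) (fun x hx => hx.2) (chartVolume_compl_source φ i),
        add_zero]
    have h2 : E ∩ i.1.source ⊆ ⋃ x ∈ t, E ∩ i.1.source ∩ U x := by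
      rw [← Set.inter_iUnion₂]
      exact Set.subset_inter subset_rfl ((Set.subset_univ _).trans ht)
    rw [h1, Measure.finsetSum_apply]
    refine (measure_mono h2).trans ((measure_biUnion_finset_le t _).trans
      (Finset.sum_le_sum fun x _ => ?_))
    rw [Measure.restrict_apply hE, chartVolume_eq_of_subset (h i (achart (Model n) x))
      (hEi.inter (hUo x).measurableSet) (fun y hy => hy.1.2) (fun y hy => hUs x hy.2)]
    exact measure_mono fun y hy => ⟨hy.1.1, hy.2⟩
  refine (hle Set.univ).trans_lt ?_
  rw [Measure.finsetSum_apply]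
  refine ENNReal.sum_lt_top.2 fun x _ => ?_
  rw [Measure.restrict_apply_univ]
  exact hUf x

theorem canonicalVolume_univ_pos [Nonempty X] {φ : atlas (Model n) X → X → ℝ}
    (hφ : ∀ i, ContinuousOn (fun x => Real.exp (-φ i x)) i.1.source) :
    0 < canonicalVolume φ Set.univ := by
  obtain ⟨x⟩ := ‹Nonempty X›
  set i := achart (Model n) x
  have hle : chartVolume φ i Set.univ ≤ canonicalVolume φ Set.univ :=
    le_iSup (chartVolume φ) i Set.univ
  refine lt_of_lt_of_le ?_ hle
  rw [chartVolume_apply MeasurableSet.univ, Set.preimage_univ, Set.inter_univ, pos_iff_ne_zero,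
    Ne, lintegral_eq_zero_iff' (aemeasurable_chart_density (hφ i))]
  intro h0
  have h1 : (volume : Measure (Model n)).restrict i.1.target = 0 := by
    rw [← ae_eq_bot]
    refine Filter.eventually_false_iff_eq_bot.1 (h0.mono fun z hz => ?_)
    have h2 : 0 < 2 ^ n * Real.exp (-φ i (i.1.symm z)) := by positivity
    exact (ENNReal.ofReal_pos.2 h2).ne' hz
  exact (i.1.open_target.measure_pos volume ⟨_, i.1.map_source (mem_chart_source _ x)⟩).ne'
    (Measure.restrict_eq_zero.1 h1)

end Finiteness

/-! ### Derivatives of power integrals at a point where all the linear forms equal one -/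

section PowerIntegralAtOne

open MeasureTheory Filter Topology

universe u

variable {X : Type*} [MeasurableSpace X] {ν : Measure X} [IsFiniteMeasure ν]
  {E : Type u} [NormedAddCommGroup E] [NormedSpace ℝ E] {L : X → E →L[ℝ] ℝ} {a b C : ℝ} {S : Set E}

/-- All powers of `L x G` are `1` at such a point and drop out. General `F` lets the formula be
reused for the derivative of the derivative. -/
theorem fderiv_powerIntegral_apply {F : Type*} [NormedAddCommGroup F] [NormedSpace ℝ F] {D : ℝ}
    (ha : 0 < a) (hS : IsOpen S) (hG : ∀ G ∈ S, ∀ x, L x G ∈ Set.Icc a b)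
    (hL : AEStronglyMeasurable L ν) (hC : ∀ x, ‖L x‖ ≤ C) {c : X → F}
    (hc : AEStronglyMeasurable c ν) (hD : ∀ x, ‖c x‖ ≤ D) (r : ℝ) {G : E} (hGS : G ∈ S)
    (h1 : ∀ x, L x G = 1) (U : E) :
    fderiv ℝ (powerIntegral ν L r c) G U = r • ∫ x, L x U • c x ∂ν := by
  have hI : Integrable (fun x => (L x).smulRight (c x)) ν :=
    Integrable.of_bound (aestronglyMeasurable_smulRight hL hc) (C * D)
      (Eventually.of_forall fun x => by
        rw [ContinuousLinearMap.norm_smulRight_apply]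
        exact mul_le_mul (hC x) (hD x) (norm_nonneg _) ((norm_nonneg _).trans (hC x)))
  rw [(hasFDerivAt_powerIntegral ha hS hG hL hC hc hD r hGS).fderiv]
  simp only [powerIntegral, h1, Real.one_rpow, one_smul]
  rw [smul_apply, ContinuousLinearMap.integral_apply hI]
  rfl

theorem fderiv_powerIntegral_one (ha : 0 < a) (hS : IsOpen S)
    (hG : ∀ G ∈ S, ∀ x, L x G ∈ Set.Icc a b)
    (hL : AEStronglyMeasurable L ν) (hC : ∀ x, ‖L x‖ ≤ C) (r : ℝ) {G : E} (hGS : G ∈ S)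
    (h1 : ∀ x, L x G = 1) (U : E) :
    fderiv ℝ (powerIntegral ν L r fun _ => (1 : ℝ)) G U = r * ∫ x, L x U ∂ν := by
  rw [fderiv_powerIntegral_apply ha hS hG hL hC (D := 1) aestronglyMeasurable_const (by simp) r hGS
    h1]
  simp

theorem fderiv_fderiv_powerIntegral_one (ha : 0 < a) (hS : IsOpen S)
    (hG : ∀ G ∈ S, ∀ x, L x G ∈ Set.Icc a b)
    (hL : AEStronglyMeasurable L ν) (hC : ∀ x, ‖L x‖ ≤ C) (r : ℝ) {G : E} (hGS : G ∈ S)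
    (h1 : ∀ x, L x G = 1) (U V : E) :
    fderiv ℝ (fderiv ℝ (powerIntegral ν L r fun _ => (1 : ℝ))) G U V =
      r * (r - 1) * ∫ x, L x U * L x V ∂ν := by
  have hm : AEStronglyMeasurable (fun _ : X => (1 : ℝ)) ν := aestronglyMeasurable_const
  have hm1 := aestronglyMeasurable_smulRight hL hm
  have hD1 : ∀ x, ‖(L x).smulRight (1 : ℝ)‖ ≤ C := fun x => by
    rw [ContinuousLinearMap.norm_smulRight_apply, norm_one, mul_one]
    exact hC x
  have hmU : AEStronglyMeasurable (fun x => L x U) ν :=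
    (ContinuousLinearMap.apply ℝ ℝ U).continuous.comp_aestronglyMeasurable hL
  have hI : Integrable (fun x => L x U • (L x).smulRight (1 : ℝ)) ν :=
    Integrable.of_bound (hmU.smul hm1) (C * ‖U‖ * C) (Eventually.of_forall fun x => by
      rw [norm_smul]
      exact mul_le_mul ((L x).le_of_opNorm_le (hC x) U) (hD1 x) (norm_nonneg _)
        (mul_nonneg ((norm_nonneg _).trans (hC x)) (norm_nonneg _)))
  have hev : fderiv ℝ (powerIntegral ν L r fun _ => (1 : ℝ)) =ᶠ[𝓝 G]
      fun G => r • powerIntegral ν L (r - 1) (fun x => (L x).smulRight (1 : ℝ)) G := by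
    filter_upwards [hS.mem_nhds hGS] with G' hG'
    exact (hasFDerivAt_powerIntegral ha hS hG hL hC hm (D := 1) (fun _ => by simp) r hG').fderiv
  have hd := (hasFDerivAt_powerIntegral ha hS hG hL hC hm1 hD1 (r - 1) hGS).differentiableAt
  rw [hev.fderiv_eq, fderiv_fun_const_smul hd, smul_apply,
    fderiv_powerIntegral_apply ha hS hG hL hC hm1 hD1 (r - 1) hGS h1, smul_apply, smul_apply,
    ContinuousLinearMap.integral_apply hI, smul_eq_mul, smul_eq_mul, mul_assoc]
  simp

end PowerIntegralAtOne

/-! ### The quantized Ding functional near the reference point -/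

section Ding

open MeasureTheory Filter Topology
open scoped ComplexOrder

variable {N : ℕ}

/-- The linear form `G ↦ tr (G M)` on hermitian matrices. -/
noncomputable def tracePairing (N : ℕ) : Matrix (Fin N) (Fin N) ℂ →ₗ[ℝ] (HermSpace N →L[ℝ] ℝ) where
  toFun M := LinearMap.toContinuousLinearMap
    { toFun := fun G => (G.toMat.1 * M).trace.re
      map_add' := fun a b => by
        rw [← Complex.add_re, ← Matrix.trace_add, ← Matrix.add_mul]
        rfl
      map_smul' := fun c a => by
        rw [RingHom.id_apply, ← smul_eq_mul, ← Complex.smul_re, ← Matrix.trace_smul,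
          ← Matrix.smul_mul]
        rfl }
  map_add' M M' := by
    ext G
    simp [Matrix.mul_add]
  map_smul' c M := by
    ext G
    simp

theorem tracePairing_apply (p : CP N) (G : HermSpace N) :
    tracePairing N (momentMap p) G = hamiltonian G.toMat p := rfl

/-- On the ball of radius `1/(2(|C|+1))` each form moves by at most `1/2` from its value `1` at the
centre; `|C| + 1` keeps the radius positive for every real `C`. -/
theorem exists_nhd_bounds {X E : Type*} [NormedAddCommGroup E] [NormedSpace ℝ E]
    {L : X → E →L[ℝ] ℝ} {C : ℝ} (hC : ∀ x, ‖L x‖ ≤ C) {G : E} (h1 : ∀ x, L x G = 1) :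
    ∃ S : Set E, IsOpen S ∧ G ∈ S ∧ ∀ G' ∈ S, ∀ x, L x G' ∈ Set.Icc (1 / 2 : ℝ) (3 / 2) := by
  have hpos : 0 < |C| + 1 := by positivity
  refine ⟨Metric.ball G (1 / (2 * (|C| + 1))), Metric.isOpen_ball,
    Metric.mem_ball_self (by positivity), fun G' hG' x => ?_⟩
  rw [Metric.mem_ball, dist_eq_norm, lt_div_iff₀ (by positivity)] at hG'
  have h2 : |L x (G' - G)| ≤ 1 / 2 := by
    calc |L x (G' - G)| ≤ ‖L x‖ * ‖G' - G‖ := (L x).le_opNorm _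
      _ ≤ (|C| + 1) * ‖G' - G‖ := by
          gcongr
          exact ((hC x).trans (le_abs_self C)).trans (le_add_of_nonneg_right zero_le_one)
      _ ≤ 1 / 2 := by linarith
  rw [map_sub, h1, abs_le] at h2
  exact ⟨by linarith [h2.1], by linarith [h2.2]⟩

theorem posDef_gram {V : Type*} [AddCommGroup V] [Module ℂ V] (b : Module.Basis (Fin N) ℂ V)
    {H : SesqForm V} (hH : IsHermForm H) : (gram b H).PosDef := by
  have hsymm : ∀ v w, (starRingEnd ℂ) (H v w) = H w v := fun v w => hH.1.eq v w
  refine Matrix.PosDef.of_dotProduct_mulVec_pos ?_ fun v hv => ?_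
  · ext i j
    exact hsymm _ _
  · have e : star v ⬝ᵥ (gram b H *ᵥ v) = H (∑ i, v i • b i) (∑ i, v i • b i) := by
      simp only [map_sum, LinearMap.sum_apply, LinearMap.map_smulₛₗ, LinearMap.smul_apply,
        dotProduct, Matrix.mulVec, gram, Matrix.of_apply, Finset.mul_sum, smul_eq_mul,
        RingHom.id_apply, Pi.star_apply, starRingEnd_apply]
      rw [Finset.sum_comm]
      refine Finset.sum_congr rfl fun i _ => Finset.sum_congr rfl fun j _ => ?_
      ring
    have hne : ∑ i, v i • b i ≠ 0 := fun h0 =>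
      hv (b.equivFun.symm.map_eq_zero_iff.1 (by rw [b.equivFun_symm_apply, h0]))
    rw [e]
    exact Complex.pos_iff.2 ⟨hH.2 _ hne, (Complex.conj_eq_iff_im.1 (hsymm _ _)).symm⟩

theorem eq_formOf_of_orthonormal {V : Type*} [AddCommGroup V] [Module ℂ V]
    (b : Module.Basis (Fin N) ℂ V) {H : SesqForm V}
    (hH : ∀ i j, H (b i) (b j) = if i = j then 1 else 0) : H = formOf b (idHerm N).1 := by
  refine b.ext fun i => b.ext fun j => ?_
  rw [hH, formOf_apply_basis]
  simp [idHerm, Matrix.one_apply]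

variable {n : ℕ} {X : Type*} [TopologicalSpace X] [ChartedSpace (Model n) X]
  [IsManifold 𝓘(ℂ, Model n) ω X] {k : ℕ}

/-- The Gram matrix is `G⁻¹`, which reverses the sign of `log det`; the reference form contributes
only a constant. -/
theorem quantizedEnergy_formOf (s : Module.Basis (Fin N) ℂ (H0 n X k))
    {Href : SesqForm (H0 n X k)} (hHref : IsHermForm Href) {G : HermSpace N} (hG : 0 < hermDet G) :
    -quantizedEnergy s Href (formOf s G.toMat.1) =
      -(1 / ((k : ℝ) * N)) * Real.log (hermDet G) +
        1 / ((k : ℝ) * N) * Real.log ((gram s Href)⁻¹).det.re := by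
  have h1 : gram s (formOf s G.toMat.1) = (G.toMat.1)⁻¹ := by
    ext i j
    exact formOf_apply_basis s _ i j
  have h2 : 0 < ((gram s Href)⁻¹).det.re :=
    (Complex.pos_iff.1 (posDef_gram s hHref).inv.det_pos).1
  rw [quantizedEnergy, h1, Matrix.det_mul, Matrix.det_nonsing_inv, Ring.inverse_eq_inv',
    det_eq_hermDet, ← Complex.ofReal_inv, Complex.re_ofReal_mul,
    Real.log_mul (inv_pos.2 hG).ne' h2.ne', Real.log_inv]
  ring

variable [MeasurableSpace X] [BorelSpace X]

/-- All dependence on `G` moves into the integrand `H(G)^{-1/k}` over the fixed measure attached to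
the identity. -/
theorem logVolume_fubiniStudy (hk : 0 < k) (s : Module.Basis (Fin N) ℂ (H0 n X k))
    (h : ∀ x : X, ∃ σ : H0 n X k, σ x ≠ 0) {G : HermSpace N} (hG : G.toMat.1.PosDef) :
    logVolume (fubiniStudyWeight (formOf s G.toMat.1) : atlas (Model n) X → X → ℝ) =
      -Real.log (powerIntegral (canonicalVolume (fubiniStudyWeight (formOf s (idHerm N).1)))
        (fun x => tracePairing N (momentMap (kodairaMap s h x))) (-(1 / (k : ℝ)))
        (fun _ => (1 : ℝ)) G) := by
  have hcont : Continuous fun x => hamiltonian G.toMat (kodairaMap s h x) := by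
    have h1 : Continuous (tracePairing N) := (tracePairing N).continuous_of_finiteDimensional
    exact (h1.comp (continuous_momentMap_kodairaMap s h)).clm_apply continuous_const
  have hm : Measurable fun x => hamiltonian G.toMat (kodairaMap s h x) ^ (-(1 / (k : ℝ))) :=
    hcont.measurable.pow_const _
  have hpos : ∀ x, 0 < hamiltonian G.toMat (kodairaMap s h x) ^ (-(1 / (k : ℝ))) := fun x =>
    Real.rpow_pos_of_pos (hamiltonian_pos hG _) _
  rw [logVolume, canonicalVolume_withDensity hm hpos
    (continuousOn_exp_neg_fubiniStudyWeight hk s h)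
    (fun i x hx => exp_neg_fubiniStudyWeight hk s h hG hx), withDensity_apply _ MeasurableSet.univ,
    Measure.restrict_univ, ← integral_eq_lintegral_of_nonneg_ae
      (Eventually.of_forall fun x => (hpos x).le) hm.aestronglyMeasurable]
  simp only [powerIntegral, tracePairing_apply, smul_eq_mul, mul_one]

end Ding

/-! ### Regularity and Hessian at the base point -/

section Ding

open MeasureTheory Filter Topology

variable {n N k : ℕ} {X : Type*} [TopologicalSpace X] [ChartedSpace (Model n) X]
  [IsManifold 𝓘(ℂ, Model n) ω X] [MeasurableSpace X] [BorelSpace X]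

theorem dingOnCone_eventuallyEq (hk : 0 < k) (s : Module.Basis (Fin N) ℂ (H0 n X k))
    (h : ∀ x : X, ∃ σ : H0 n X k, σ x ≠ 0) {Href : SesqForm (H0 n X k)} (hHref : IsHermForm Href) :
    (fun G : HermSpace N => dingOnCone s Href G.toMat) =ᶠ[𝓝 (HermSpace.ofMat (idHerm N))]
      fun G => (-(1 / ((k : ℝ) * N)) * Real.log (hermDet G) +
        1 / ((k : ℝ) * N) * Real.log ((gram s Href)⁻¹).det.re) +
        -Real.log (powerIntegral (canonicalVolume (fubiniStudyWeight (formOf s (idHerm N).1)))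
          (fun x => tracePairing N (momentMap (kodairaMap s h x))) (-(1 / (k : ℝ)))
          (fun _ => (1 : ℝ)) G) := by
  filter_upwards [eventually_posDef, eventually_hermDet_pos] with G h1 h2
  rw [dingOnCone, quantizedDing, quantizedEnergy_formOf s hHref h2, logVolume_fubiniStudy hk s h h1]

theorem isFiniteMeasure_canonicalVolume [CompactSpace X] (hk : 0 < k)
    (s : Module.Basis (Fin N) ℂ (H0 n X k)) (h : ∀ x : X, ∃ σ : H0 n X k, σ x ≠ 0) :
    IsFiniteMeasure (canonicalVolume (fubiniStudyWeight (formOf s (idHerm N).1)) : Measure X) :=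
  ⟨canonicalVolume_univ_lt_top (continuousOn_exp_neg_fubiniStudyWeight hk s h)
    fun _ _ _ hi hj => exp_neg_fubiniStudyWeight_change hk s h hi hj⟩

theorem contDiffAt_dingOnCone_and_hessian [CompactSpace X] [Nonempty X] (hk : 0 < k)
    (s : Module.Basis (Fin N) ℂ (H0 n X k))
    (h : ∀ x : X, ∃ σ : H0 n X k, σ x ≠ 0) {Href : SesqForm (H0 n X k)} (hHref : IsHermForm Href) :
    ContDiffAt ℝ 2 (dingOnCone s Href) (idHerm N) ∧
    (∀ A B : HermMat N,
      riemannianHessian (dingOnCone s Href) (idHerm N) A B =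
        (k : ℝ)⁻¹ * (∫ x, (fsInner (kodairaMap s h x) (xi A (kodairaMap s h x))
            (xi B (kodairaMap s h x))).re
          ∂(canonicalProbability (fubiniStudyWeight (formOf s (idHerm N).1))))
        - ((k : ℝ) ^ 2)⁻¹ * (∫ x, hamiltonian A (kodairaMap s h x) *
            hamiltonian B (kodairaMap s h x)
          ∂(canonicalProbability (fubiniStudyWeight (formOf s (idHerm N).1))))
        + ((k : ℝ) ^ 2)⁻¹ *
          ((∫ x, hamiltonian A (kodairaMap s h x)
            ∂(canonicalProbability (fubiniStudyWeight (formOf s (idHerm N).1)))) *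
          (∫ x, hamiltonian B (kodairaMap s h x)
            ∂(canonicalProbability (fubiniStudyWeight (formOf s (idHerm N).1)))))) := by
  have hk' : (k : ℝ) ≠ 0 := by exact_mod_cast hk.ne'
  rw [canonicalProbability]
  have hfin := isFiniteMeasure_canonicalVolume hk s h
  have hpos := canonicalVolume_univ_pos (continuousOn_exp_neg_fubiniStudyWeight hk s h)
  set ν : Measure X := canonicalVolume (fubiniStudyWeight (formOf s (idHerm N).1)) with hν
  set L : X → HermSpace N →L[ℝ] ℝ := fun x => tracePairing N (momentMap (kodairaMap s h x)) with hLdef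
  have hLc : Continuous L :=
    (tracePairing N).continuous_of_finiteDimensional.comp (continuous_momentMap_kodairaMap s h)
  obtain ⟨C, hC'⟩ := isCompact_univ.exists_bound_of_continuousOn hLc.continuousOn
  have hC : ∀ x, ‖L x‖ ≤ C := fun x => hC' x (Set.mem_univ x)
  have hL : AEStronglyMeasurable L ν := hLc.aestronglyMeasurable
  have hint : ∀ f : X → ℝ, Continuous f → Integrable f ν := fun f hf =>
    hf.integrable_of_hasCompactSupport (HasCompactSupport.of_compactSpace f)
  have hLA : ∀ A : HermMat N, Continuous fun x => hamiltonian A (kodairaMap s h x) := fun A =>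
    hLc.clm_apply (continuous_const (y := HermSpace.ofMat A))
  set e := HermSpace.ofMat (idHerm N) with he
  have h1 : ∀ x, L x e = 1 := fun x => hamiltonian_idHerm _
  obtain ⟨S, hS, heS, hSb⟩ := exists_nhd_bounds hC h1
  set r : ℝ := -(1 / (k : ℝ)) with hr
  set I := powerIntegral ν L r fun _ => (1 : ℝ) with hI
  set V : ℝ := ν.real Set.univ with hV
  have hV0 : V ≠ 0 := (ENNReal.toReal_pos hpos.ne' (measure_ne_top _ _)).ne'
  have hIe : I e = V := by
    simp [hI, powerIntegral, h1, hV]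
  have hI2 : ContDiffAt ℝ 2 I e :=
    (contDiffOn_powerIntegral (by norm_num) hS hSb hL hC 2 (D := 1) aestronglyMeasurable_const
      (fun _ => by simp) r).contDiffAt (hS.mem_nhds heS)
  have hlogI : ContDiffAt ℝ 2 (fun G => -Real.log (I G)) e := (hI2.log (by rwa [hIe])).neg
  have hlogD : ContDiffAt ℝ 2 (fun G : HermSpace N => -(1 / ((k : ℝ) * N)) * Real.log (hermDet G) +
      1 / ((k : ℝ) * N) * Real.log ((gram s Href)⁻¹).det.re) e :=
    (contDiffAt_const.mul contDiffAt_log_hermDet).add contDiffAt_const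
  have hev := dingOnCone_eventuallyEq hk s h hHref
  have hD1 : ∀ U, fderiv ℝ I e U = r * ∫ x, L x U ∂ν :=
    fderiv_powerIntegral_one (by norm_num) hS hSb hL hC r heS h1
  have hD2 : ∀ U W, fderiv ℝ (fderiv ℝ I) e U W = r * (r - 1) * ∫ x, L x U * L x W ∂ν :=
    fderiv_fderiv_powerIntegral_one (by norm_num) hS hSb hL hC r heS h1
  refine ⟨(hlogD.add hlogI).congr_of_eventuallyEq hev, fun A B => ?_⟩
  have hfd : fderiv ℝ (fun G => -Real.log (I G)) e = -((I e)⁻¹ • fderiv ℝ I e) :=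
    ((hI2.differentiableAt (by simp)).hasFDerivAt.log (by rwa [hIe])).neg.fderiv
  -- Derivatives depend only on the germ at the base point, so the explicit formula near the
  -- identity may be substituted.
  rw [riemannianHessian_eq, hev.fderiv.fderiv_eq, hev.fderiv_eq, fderiv_fderiv_add hlogD hlogI,
    fderiv_fun_add (hlogD.differentiableAt (by simp)) (hlogI.differentiableAt (by simp)),
    fderiv_fderiv_const_mul_add, fderiv_const_mul_add, hfd]
  simp only [add_apply, smul_apply, neg_apply, smul_eq_mul]
  rw [fderiv_fderiv_neg_log hI2 (by rwa [hIe]), hessian_log_hermDet, hD2, hD1, hD1, hD1, hIe]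
  have hLe : ∀ (A : HermMat N) x, L x (HermSpace.ofMat A) = hamiltonian A (kodairaMap s h x) :=
    fun _ _ => rfl
  simp only [hLe, fsInner_xi_re, integral_smul_measure, smul_eq_mul]
  have hsub : ∫ x, (-hamiltonian (christoffel (idHerm N) A B) (kodairaMap s h x) -
      hamiltonian A (kodairaMap s h x) * hamiltonian B (kodairaMap s h x)) ∂ν =
      -∫ x, hamiltonian (christoffel (idHerm N) A B) (kodairaMap s h x) ∂ν -
        ∫ x, hamiltonian A (kodairaMap s h x) * hamiltonian B (kodairaMap s h x) ∂ν := by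
    rw [← integral_neg]
    exact integral_sub (hint _ (hLA _).neg) (hint _ ((hLA A).mul (hLA B)))
  have hVi : ((ν Set.univ)⁻¹).toReal = V⁻¹ := ENNReal.toReal_inv _
  -- The second derivative of the `log det` term cancels against its Christoffel correction here.
  -- The rest is algebra with `r(r - 1) = 1/k² + 1/k`.
  rw [hsub, hVi, hr, add_sub_add_left_eq_sub]
  field_simp
  ring

end Ding

end QuantizedDing

theorem theorem1p1 {n : ℕ} {X : Type*} [TopologicalSpace X] [T2Space X] [CompactSpace X]
    [ConnectedSpace X] [MeasurableSpace X] [BorelSpace X] [ChartedSpace (Model n) X]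
    [IsManifold 𝓘(ℂ, Model n) ω X] (hX : IsFano n X)
    {k : ℕ} (hk : 0 < k) (hva : IsVeryAmple n X k)
    {N : ℕ} (H₀ Href : SesqForm (H0 n X k)) (hH₀ : IsHermForm H₀) (hHref : IsHermForm Href)
    (s₀ : Module.Basis (Fin N) ℂ (H0 n X k))
    (hs₀ : ∀ i j, H₀ (s₀ i) (s₀ j) = if i = j then 1 else 0)
    (ι : X → CP N) (hι : ι = kodairaMap s₀ hva.basePointFree)
    (μ : MeasureTheory.Measure X) (hμ : μ = canonicalProbability (fubiniStudyWeight H₀)) :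
    -- the functional is twice differentiable at `H₀`, and its Hessian there is:
    ContDiffAt ℝ 2 (dingOnCone s₀ Href) (idHerm N) ∧
    (∀ A B : HermMat N,
      riemannianHessian (dingOnCone s₀ Href) (idHerm N) A B =
        (k : ℝ)⁻¹ * (∫ x, (fsInner (ι x) (xi A (ι x)) (xi B (ι x))).re ∂μ)
        - ((k : ℝ) ^ 2)⁻¹ * (∫ x, hamiltonian A (ι x) * hamiltonian B (ι x) ∂μ)
        + ((k : ℝ) ^ 2)⁻¹ *
          ((∫ x, hamiltonian A (ι x) ∂μ) * (∫ x, hamiltonian B (ι x) ∂μ))) ∧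
    -- `H(A)` is the Hamiltonian of `J ξ_A^ℝ`: its differential is `-4π ω_FS(J ξ_A^ℝ, ·)`
    (∀ (A : HermMat N) (p : CP N) (Z : p.submodule) (w : Vec N) (η : TangentCP p), Z ≠ 0 →
      η Z = p.submodule.mkQ w →
      HasDerivAt (fun t : ℝ => (A.1 * momentMatrix ((Z : Vec N) + t • w)).trace.re)
        (-(4 * Real.pi) * fsForm p (Complex.I • xiReal A p) η) 0) := by
  subst hι hμ
  -- Orthonormality of the basis says that `H₀` is the point of the cone given by the identity
  -- matrix.
  rw [eq_formOf_of_orthonormal s₀ hs₀]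
  obtain ⟨h1, h2⟩ := contDiffAt_dingOnCone_and_hessian hk s₀ hva.basePointFree hHref
  exact ⟨h1, h2, hasDerivAt_trace_mul_momentMatrix⟩
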